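/- Let $M$ be a compact $n$-dimensional smooth manifold without boundary, with a smooth Riemannian metric $g$, Riemannian volume measure $\mu$, gradient $\nabla$ and divergence $\operatorname{div}$ (with respect to $\mu$). Let $J\subseteq\mathbb R$ be an interval containing $0$, let $u_0$ be a smooth vector field on $M$, and let $u=u(t,x)$ be a time-dependent vector field, smooth on $J\times M$, such that $h=\operatorname{div}u$ solves the Euler–Arnold equation of the homogeneous $\dot H^1$ metric $$h_t+\langle u,\nabla h\rangle+\tfrac12h^2=-\frac1{2\mu(M)}\int_M h^2\,d\mu\quad\text{on }J\times M,\qquad h(0,x)=\operatorname{div}u_0(x).$$ Let $\eta$ be the flow of $u$, that is, the smooth map $\eta:J\times M\to M$ (smooth curve in the diffeomorphism group) with $\frac{d}{dt}\eta(t,x)=u(t,\eta(t,x))$ and $\eta(0,x)=x$. Let $\kappa\in\mathbb R$ satisfy $$\kappa^2=\frac1{4\mu(M)}\int_M(\operatorname{div}u_0)^2\,d\mu .$$ Then this quantity is conserved: $\frac1{4\mu(M)}\int_M(\operatorname{div}u(t,\cdot))^2\,d\mu=\kappa^2$ for all $t\in J$. If $\kappa\neq0$, then for all $t\in J$ and $x\in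 M$ $$h(t,\eta(t,x))=2\kappa\tan\Big(\arctan\frac{\operatorname{div}u_0(x)}{2\kappa}-\kappa t\Big),\qquad \mathrm{Jac}_\mu\eta(t,x)=\Big(\cos\kappa t+\frac{\operatorname{div}u_0(x)}{2\kappa}\sin\kappa t\Big)^2,$$ where $\mathrm{Jac}_\mu\eta(t,\cdot)$ is the Jacobian of $x\mapsto\eta(t,x)$ with respect to $\mu$, that is, $\eta(t,\cdot)^*\mu=\mathrm{Jac}_\mu\eta(t,\cdot)\,\mu$ as densities. If $\kappa=0$, then $h(t,\eta(t,x))=0$ and $\mathrm{Jac}_\mu\eta(t,x)=1$ for all $t\in J$ and $x\in M$. -/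

import Mathlib

open scoped Manifold ContDiff
open Set MeasureTheory

noncomputable section

namespace FisherRao

/-- A smooth Riemannian metric on a smooth `n`-manifold without boundary. -/
abbrev Metric (n : ℕ) (M : Type*) [TopologicalSpace M] [ChartedSpace (EuclideanSpace ℝ (Fin n)) M]
    [IsManifold (𝓡 n) ∞ M] :=
  Bundle.ContMDiffRiemannianMetric (𝓡 n) ∞ (EuclideanSpace ℝ (Fin n))
    (fun x : M => TangentSpace (𝓡 n) x)

section

variable {n : ℕ} {M : Type*} [TopologicalSpace M] [ChartedSpace (EuclideanSpace ℝ (Fin n)) M]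
  [IsManifold (𝓡 n) ∞ M]

/-- The inner product of `g` at `x`, as a bilinear form on the tangent space. -/
def metricForm (g : Metric n M) (x : M) : LinearMap.BilinForm ℝ (TangentSpace (𝓡 n) x) :=
  LinearMap.mk₂ ℝ (fun v w => g.inner x v w)
    (by intros; simp) (by intros; simp) (by intros; simp) (by intros; simp)

theorem metricForm_nondegenerate (g : Metric n M) (x : M) : (metricForm g x).Nondegenerate := by
  constructor
  · intro v hv
    by_contra hne
    exact (g.pos x v hne).ne' (hv v)
  · intro v hv
    by_contra hne
    exact (g.pos x v hne).ne' (hv v)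

instance tangentFiniteDimensional (x : M) : FiniteDimensional ℝ (TangentSpace (𝓡 n) x) :=
  inferInstanceAs (FiniteDimensional ℝ (EuclideanSpace ℝ (Fin n)))

/-- The Riemannian gradient of `f` at `x`: the vector `∇f` with `⟨∇f, w⟩ = df(w)` for all `w`. -/
def gradient (g : Metric n M) (f : M → ℝ) (x : M) : TangentSpace (𝓡 n) x :=
  ((metricForm g x).toDual (metricForm_nondegenerate g x)).symm
    (mfderiv (𝓡 n) 𝓘(ℝ, ℝ) f x).toLinearMap

/-- The Gram determinant `det (⟨vᵢ, vⱼ⟩)` of `n` tangent vectors at `x`. -/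
def gramDet (g : Metric n M) (x : M) (v : Fin n → TangentSpace (𝓡 n) x) : ℝ :=
  (Matrix.of fun i j => g.inner x (v i) (v j)).det

/-- The coordinate vector field `∂/∂zⁱ` of the chart centred at `c`, at the point with
coordinates `z`. -/
def coordVector (c : M) (z : EuclideanSpace ℝ (Fin n)) (i : Fin n) :
    TangentSpace (𝓡 n) ((extChartAt (𝓡 n) c).symm z) :=
  mfderiv (𝓡 n) (𝓡 n) (extChartAt (𝓡 n) c).symm z (EuclideanSpace.single i (1 : ℝ))

/-- The density `√(det g)` in the coordinates `z` of the chart centred at `c`. -/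
def sqrtDetMetric (g : Metric n M) (c : M) (z : EuclideanSpace ℝ (Fin n)) : ℝ :=
  Real.sqrt (gramDet g ((extChartAt (𝓡 n) c).symm z) (coordVector c z))

/-- The `i`-th component of the vector field `u` in the chart centred at `c`. -/
def coordComponent (u : (x : M) → TangentSpace (𝓡 n) x) (c : M) (i : Fin n)
    (z : EuclideanSpace ℝ (Fin n)) : ℝ :=
  (show EuclideanSpace ℝ (Fin n) from
    mfderiv (𝓡 n) (𝓡 n) (extChartAt (𝓡 n) c) ((extChartAt (𝓡 n) c).symm z)
      (u ((extChartAt (𝓡 n) c).symm z))) i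

/-- The divergence of `u` with respect to the Riemannian volume,
`div u = (det g)^(-1/2) ∑ᵢ ∂ᵢ ((det g)^(1/2) uⁱ)`, computed at `x` in the chart centred at `x`. -/
def divergence (g : Metric n M) (u : (x : M) → TangentSpace (𝓡 n) x) (x : M) : ℝ :=
  (∑ i : Fin n, fderiv ℝ (fun z => sqrtDetMetric g x z * coordComponent u x i z)
      (extChartAt (𝓡 n) x x) (EuclideanSpace.single i (1 : ℝ))) /
    sqrtDetMetric g x (extChartAt (𝓡 n) x x)

/-- The measure `√(det g) dz` on the domain of the chart centred at `c`, extended by zero to `M`. -/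
def chartVolume [MeasurableSpace M] (g : Metric n M) (c : M) : Measure M :=
  ((volume.restrict (extChartAt (𝓡 n) c).target).withDensity
    (fun z => ENNReal.ofReal (sqrtDetMetric g c z))).map (extChartAt (𝓡 n) c).symm

/-- The Riemannian volume measure. The measures `chartVolume g c` agree on overlaps of the chart
domains, and their supremum is the measure that restricts to each of them. -/
def volumeMeasure [MeasurableSpace M] (g : Metric n M) : Measure M :=
  ⨆ c : M, chartVolume g c

/-- The Jacobian of `φ` with respect to the Riemannian volume density `μ`, that is, the function
`J` with `φ^* μ = J μ`: the factor by which `dφ` changes the `n`-dimensional volume of a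
parallelepiped in the tangent space at `x`. The tangent space is by definition
`EuclideanSpace ℝ (Fin n)`, whose standard basis is used; any basis gives the same value. -/
def jacobian (g : Metric n M) (φ : M → M) (x : M) : ℝ :=
  let e : Fin n → TangentSpace (𝓡 n) x := fun i => EuclideanSpace.single i (1 : ℝ)
  Real.sqrt (gramDet g (φ x) (fun i => mfderiv (𝓡 n) (𝓡 n) φ x (e i))) /
    Real.sqrt (gramDet g x e)

/-- A time-dependent vector field, smooth on `J × M`. -/
def SmoothTimeDependentField (J : Set ℝ) (u : ℝ → (x : M) → TangentSpace (𝓡 n) x) : Prop :=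
  ContMDiffOn (𝓘(ℝ, ℝ).prod (𝓡 n)) (𝓡 n).tangent ∞
    (fun p : ℝ × M => (⟨p.2, u p.1 p.2⟩ : TangentBundle (𝓡 n) M)) (J ×ˢ univ)

/-- `h = div u` solves the Euler–Arnold equation of the homogeneous `H¹` metric on `J × M`:
`h_t + ⟨u, ∇h⟩ + h² / 2 = - 1 / (2 μ(M)) ∫ h² dμ`. -/
def SolvesEulerArnold [MeasurableSpace M] (g : Metric n M) (J : Set ℝ)
    (u : ℝ → (x : M) → TangentSpace (𝓡 n) x) (h : ℝ → M → ℝ) : Prop :=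
  (∀ t ∈ J, ∀ x, h t x = divergence g (u t) x) ∧
  ∀ t ∈ J, ∀ x, ∃ h' : ℝ, HasDerivWithinAt (fun s => h s x) h' J t ∧
    h' + g.inner x (u t x) (gradient g (h t) x) + 1 / 2 * h t x ^ 2 =
      -(1 / (2 * (volumeMeasure g).real univ)) * ∫ y, h t y ^ 2 ∂(volumeMeasure g)

/-- `η` is the flow of `u` for times in `J`: a smooth curve of smooth maps (that is, jointly smooth
on `J × M`) with `dη(t,x)/dt = u(t, η(t,x))` and `η(0,x) = x`. -/
structure IsFlow (J : Set ℝ) (u : ℝ → (x : M) → TangentSpace (𝓡 n) x) (η : ℝ → M → M) :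
    Prop where
  smooth : ContMDiffOn (𝓘(ℝ, ℝ).prod (𝓡 n)) (𝓡 n) ∞ (fun p : ℝ × M => η p.1 p.2) (J ×ˢ univ)
  initial : ∀ x, η 0 x = x
  velocity : ∀ t ∈ J, ∀ x, HasMFDerivWithinAt 𝓘(ℝ, ℝ) (𝓡 n) (fun s => η s x) J t
    ((1 : ℝ →L[ℝ] ℝ).smulRight (u t (η t x)))

end

end FisherRao

end

noncomputable section

namespace FisherRao

/-! ### Gram determinants and the Jacobian in charts -/

section Gram

variable {n : ℕ} {M : Type*} [TopologicalSpace M] [ChartedSpace (EuclideanSpace ℝ (Fin n)) M]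
  [IsManifold (𝓡 n) ∞ M]

/-! Along a trajectory the equation becomes a scalar one. Fix `x` and write `ρ(t)` for the Jacobian
of the flow at `x` and `y(t) = h(t, η(t,x))`. Liouville's formula gives `ρ' = y ρ`, and the chain
rule turns the Euler–Arnold equation into the Riccati equation `y' = -y²/2 - C/2`, where `C(t)` is
the mean of `h(t,·)²`. Hence `φ = √ρ` satisfies `φ' = yφ/2` and `φ'' = -(C/4) φ`, the same linear
equation for every `x`. Once `C` is known to be the constant `4κ²`, this is the harmonic oscillator
with `φ(0) = 1` and `φ'(0) = div u₀(x)/2`, which is solved explicitly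
(`density_eq_of_speed_ne_zero`, `density_eq_one_of_speed_zero`).

Conservation of `C` is proved without differentiating under the integral sign. Two roots `φ_x` and
`φ_{x₀}` have constant Wronskian, so `φ_x / φ_{x₀} = 1 + w(x) T(t)` with `w = (h(0,·) - h(0,x₀))/2`
and, unless `w` vanishes identically, `T' = 1/ρ_{x₀}`. The flow maps are bijections of `M`, so `∫ ρ
dμ = m` with `m = μ(M)`, that is `ρ_{x₀} (m + 2AT + BT²) = m` with `A = ∫ w`, `B = ∫ w²`.
Differentiating this identity twice forces `C = 4(Bm - A²)/m²` (`speed_eq_of_mass_eq`). If `w`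
vanishes identically, the mass forces `ρ = 1` and the same computation applies with `T(t) = t`.

The geometric input is Liouville's formula (`flowGram_hasDerivWithinAt`), the independence of the
divergence from the chart (`chartDiv_transition`), bijectivity of the flow maps (`IsFlow.bijective`)
and the change of variables (`integral_jacobian`). Since `J` may contain its end points, time
derivatives are taken within `J` throughout. -/

theorem gramDet_comp (g : Metric n M) (x : M)
    (K : EuclideanSpace ℝ (Fin n) →L[ℝ] TangentSpace (𝓡 n) x)
    (A : EuclideanSpace ℝ (Fin n) →L[ℝ] EuclideanSpace ℝ (Fin n)) :
    gramDet g x (fun i => K (A (EuclideanSpace.single i (1 : ℝ)))) =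
      A.det ^ 2 * gramDet g x (fun i => K (EuclideanSpace.single i (1 : ℝ))) := by
  set b := (EuclideanSpace.basisFun (Fin n) ℝ).toBasis with hb
  set B := LinearMap.toMatrix b b (A : EuclideanSpace ℝ (Fin n) →ₗ[ℝ] _) with hB
  have hdet : A.det = B.det := (LinearMap.det_toMatrix b _).symm
  have hbi : ∀ i, b i = EuclideanSpace.single i (1 : ℝ) := fun i => by simp [hb]
  have hA : ∀ i, A (EuclideanSpace.single i (1 : ℝ)) =
      ∑ k, B k i • EuclideanSpace.single k (1 : ℝ) := by
    intro i
    have h := b.sum_repr (A (b i))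
    simp only [hbi] at h
    rw [← h]
    refine Finset.sum_congr rfl fun k _ => ?_
    rw [hB, LinearMap.toMatrix_apply, hbi]
    rfl
  -- The Gram matrix transforms by congruence, which is where the square of the determinant comes
  -- from.
  have hG : (Matrix.of fun i j => g.inner x (K (A (EuclideanSpace.single i (1 : ℝ))))
      (K (A (EuclideanSpace.single j (1 : ℝ))))) =
      B.transpose * (Matrix.of fun i j => g.inner x (K (EuclideanSpace.single i (1 : ℝ)))
      (K (EuclideanSpace.single j (1 : ℝ)))) * B := by
    ext i j
    simp only [Matrix.of_apply, Matrix.mul_apply, Matrix.transpose_apply, hA, map_sum, map_smul,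
      sum_apply, smul_apply, smul_eq_mul, Finset.mul_sum,
      Finset.sum_mul]
    refine Finset.sum_congr rfl fun k _ => Finset.sum_congr rfl fun l _ => ?_
    ring
  rw [gramDet, hG, Matrix.det_mul, Matrix.det_mul, Matrix.det_transpose, hdet, gramDet]
  ring

theorem gramDet_pos (g : Metric n M) (x : M)
    (K : EuclideanSpace ℝ (Fin n) →L[ℝ] TangentSpace (𝓡 n) x) (hK : Function.Injective K) :
    0 < gramDet g x (fun i => K (EuclideanSpace.single i (1 : ℝ))) := by
  refine Matrix.PosDef.det_pos ?_
  refine Matrix.PosDef.of_dotProduct_mulVec_pos ?_ ?_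
  · ext i j
    simp [g.symm x]
  · intro v hv
    -- The quadratic form of the Gram matrix at `v` is the squared length of this vector.
    have hw : K (∑ i, v i • EuclideanSpace.single i (1 : ℝ)) ≠ 0 := by
      intro h0
      apply hv
      have h1 : (∑ i, v i • EuclideanSpace.single i (1 : ℝ) : EuclideanSpace ℝ (Fin n)) = 0 :=
        hK (h0.trans (map_zero K).symm)
      ext j
      have h2 := congrArg (fun w : EuclideanSpace ℝ (Fin n) => w j) h1
      simpa [Pi.single_apply] using h2
    have := g.pos x _ hw
    simp only [map_sum, map_smul, sum_apply, smul_apply,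
      smul_eq_mul] at this
    simp only [dotProduct, Matrix.mulVec, Matrix.of_apply, Pi.star_apply, star_trivial]
    refine this.trans_eq (Finset.sum_congr rfl fun i _ => ?_)
    congr 1
    refine Finset.sum_congr rfl fun j _ => ?_
    rw [g.symm, mul_comm]

/-- The manifold derivative of `φ` at `x`, read as an endomorphism of the model space. -/
def modelDeriv (n : ℕ) {N : Type*} [TopologicalSpace N] [ChartedSpace (EuclideanSpace ℝ (Fin n)) N]
    {N' : Type*} [TopologicalSpace N'] [ChartedSpace (EuclideanSpace ℝ (Fin n)) N']
    (φ : N → N') (x : N) : EuclideanSpace ℝ (Fin n) →L[ℝ] EuclideanSpace ℝ (Fin n) :=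
  mfderiv (𝓡 n) (𝓡 n) φ x

theorem modelDeriv_symm_comp (c : M) {z : EuclideanSpace ℝ (Fin n)}
    (hz : z ∈ (extChartAt (𝓡 n) c).target) :
    (modelDeriv n (extChartAt (𝓡 n) c).symm z) ∘L
      (modelDeriv n (extChartAt (𝓡 n) c) ((extChartAt (𝓡 n) c).symm z)) =
      ContinuousLinearMap.id ℝ (EuclideanSpace ℝ (Fin n)) := by
  have := mfderivWithin_extChartAt_symm_comp_mfderiv_extChartAt (I := 𝓡 n) hz
  simp only [modelWithCornersSelf_coe, range_id, mfderivWithin_univ] at this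
  exact this

theorem modelDeriv_comp_symm (c : M) {z : EuclideanSpace ℝ (Fin n)}
    (hz : z ∈ (extChartAt (𝓡 n) c).target) :
    (modelDeriv n (extChartAt (𝓡 n) c) ((extChartAt (𝓡 n) c).symm z)) ∘L
      (modelDeriv n (extChartAt (𝓡 n) c).symm z) =
      ContinuousLinearMap.id ℝ (EuclideanSpace ℝ (Fin n)) := by
  have := mfderiv_extChartAt_comp_mfderivWithin_extChartAt_symm (I := 𝓡 n) hz
  simp only [modelWithCornersSelf_coe, range_id, mfderivWithin_univ] at this
  exact this

theorem gramDet_coordVector_pos (g : Metric n M) (c : M) {z : EuclideanSpace ℝ (Fin n)}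
    (hz : z ∈ (extChartAt (𝓡 n) c).target) :
    0 < gramDet g ((extChartAt (𝓡 n) c).symm z) (coordVector c z) := by
  refine gramDet_pos g _ (modelDeriv n (extChartAt (𝓡 n) c).symm z) ?_
  refine Function.LeftInverse.injective (g := modelDeriv n (extChartAt (𝓡 n) c)
    ((extChartAt (𝓡 n) c).symm z)) fun v => ?_
  exact DFunLike.congr_fun (modelDeriv_comp_symm c hz) v

theorem sqrtDetMetric_pos (g : Metric n M) (c : M) {z : EuclideanSpace ℝ (Fin n)}
    (hz : z ∈ (extChartAt (𝓡 n) c).target) : 0 < sqrtDetMetric g c z :=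
  Real.sqrt_pos.2 (gramDet_coordVector_pos g c hz)

theorem sqrtDetMetric_sq (g : Metric n M) (c : M) {z : EuclideanSpace ℝ (Fin n)}
    (hz : z ∈ (extChartAt (𝓡 n) c).target) : sqrtDetMetric g c z ^ 2 =
      gramDet g ((extChartAt (𝓡 n) c).symm z) (coordVector c z) :=
  Real.sq_sqrt (gramDet_coordVector_pos g c hz).le

/-- The Gram determinant of the columns of a linear map, computed in a chart. -/
theorem gramDet_eq_chart (g : Metric n M) (c : M) {y : M}
    (hy : y ∈ (extChartAt (𝓡 n) c).source)
    (L : EuclideanSpace ℝ (Fin n) →L[ℝ] EuclideanSpace ℝ (Fin n)) :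
    gramDet g y (fun i => L (EuclideanSpace.single i (1 : ℝ))) =
      (sqrtDetMetric g c (extChartAt (𝓡 n) c y) *
        ((modelDeriv n (extChartAt (𝓡 n) c) y) ∘L L).det) ^ 2 := by
  obtain ⟨z, hz, rfl⟩ : ∃ z ∈ (extChartAt (𝓡 n) c).target, (extChartAt (𝓡 n) c).symm z = y :=
    ⟨_, (extChartAt (𝓡 n) c).map_source hy, (extChartAt (𝓡 n) c).left_inv hy⟩
  rw [(extChartAt (𝓡 n) c).right_inv hz, mul_pow, sqrtDetMetric_sq g c hz, mul_comm]
  have := gramDet_comp g ((extChartAt (𝓡 n) c).symm z) (modelDeriv n (extChartAt (𝓡 n) c).symm z)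
    ((modelDeriv n (extChartAt (𝓡 n) c) ((extChartAt (𝓡 n) c).symm z)) ∘L L)
  refine Eq.trans ?_ this
  congr 1
  ext1 i
  exact (DFunLike.congr_fun (modelDeriv_symm_comp c hz) _).symm

theorem hasMFDerivAt_of_eq {N N' : Type*} [TopologicalSpace N]
    [ChartedSpace (EuclideanSpace ℝ (Fin n)) N] [TopologicalSpace N']
    [ChartedSpace (EuclideanSpace ℝ (Fin n)) N'] {φ : N → N'} {p x : N} (h : p = x)
    (H : MDifferentiableAt (𝓡 n) (𝓡 n) φ x) :
    HasMFDerivAt (𝓡 n) (𝓡 n) φ p (modelDeriv n φ x) := by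
  subst h; exact H.hasMFDerivAt

theorem mdifferentiableAt_extChartAt_symm (c : M) {z : EuclideanSpace ℝ (Fin n)}
    (hz : z ∈ (extChartAt (𝓡 n) c).target) :
    MDifferentiableAt (𝓡 n) (𝓡 n) (extChartAt (𝓡 n) c).symm z := by
  have := mdifferentiableWithinAt_extChartAt_symm (I := 𝓡 n) hz
  simpa only [modelWithCornersSelf_coe, range_id, mdifferentiableWithinAt_univ] using this

theorem hasFDerivAt_chart_comp (c c' : M) (φ : M → M) {x : M}
    (hx : x ∈ (extChartAt (𝓡 n) c).source) (hφx : φ x ∈ (extChartAt (𝓡 n) c').source)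
    (hφ : MDifferentiableAt (𝓡 n) (𝓡 n) φ x) :
    HasFDerivAt (extChartAt (𝓡 n) c' ∘ φ ∘ (extChartAt (𝓡 n) c).symm)
      ((modelDeriv n (extChartAt (𝓡 n) c') (φ x)) ∘L (modelDeriv n φ x) ∘L
        (modelDeriv n (extChartAt (𝓡 n) c).symm (extChartAt (𝓡 n) c x)))
      (extChartAt (𝓡 n) c x) := by
  have hxx := (extChartAt (𝓡 n) c).left_inv hx
  have h1 := hasMFDerivAt_of_eq rfl
    (mdifferentiableAt_extChartAt_symm c ((extChartAt (𝓡 n) c).map_source hx))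
  have h3 := hasMFDerivAt_of_eq hxx hφ
  have h4 := hasMFDerivAt_of_eq (congrArg φ hxx)
    (mdifferentiableAt_extChartAt (I := 𝓡 n) (x := c') (y := φ x) (by simpa using hφx))
  exact (HasMFDerivAt.comp _ (f := φ ∘ (extChartAt (𝓡 n) c).symm) h4
    (h3.comp _ h1)).hasFDerivAt

theorem fderiv_chart_comp (c c' : M) (φ : M → M) {x : M}
    (hx : x ∈ (extChartAt (𝓡 n) c).source) (hφx : φ x ∈ (extChartAt (𝓡 n) c').source)
    (hφ : MDifferentiableAt (𝓡 n) (𝓡 n) φ x) :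
    (fderiv ℝ (extChartAt (𝓡 n) c' ∘ φ ∘ (extChartAt (𝓡 n) c).symm) (extChartAt (𝓡 n) c x)) ∘L
      (modelDeriv n (extChartAt (𝓡 n) c) x) =
      ((modelDeriv n (extChartAt (𝓡 n) c') (φ x)) ∘L (modelDeriv n φ x)) := by
  rw [(hasFDerivAt_chart_comp c c' φ hx hφx hφ).fderiv]
  have h := modelDeriv_symm_comp c ((extChartAt (𝓡 n) c).map_source hx)
  rw [(extChartAt (𝓡 n) c).left_inv hx] at h
  rw [ContinuousLinearMap.comp_assoc, ContinuousLinearMap.comp_assoc, h,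
    ContinuousLinearMap.comp_id]

theorem det_modelDeriv_extChartAt_ne_zero (c : M) {x : M}
    (hx : x ∈ (extChartAt (𝓡 n) c).source) : (modelDeriv n (extChartAt (𝓡 n) c) x).det ≠ 0 := by
  have h := congrArg ContinuousLinearMap.det
    (modelDeriv_symm_comp c ((extChartAt (𝓡 n) c).map_source hx))
  rw [(extChartAt (𝓡 n) c).left_inv hx] at h
  have h2 := (LinearMap.det_comp (M := EuclideanSpace ℝ (Fin n)) _ _).symm.trans
    (h.trans LinearMap.det_id)
  exact right_ne_zero_of_mul (h2.trans_ne one_ne_zero)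

/-- The Gram determinant of the image under `dφ` of the standard frame at `x`, in charts. -/
theorem gramDet_modelDeriv_eq_chart (g : Metric n M) (c c' : M) (φ : M → M) {x : M}
    (hx : x ∈ (extChartAt (𝓡 n) c).source) (hφx : φ x ∈ (extChartAt (𝓡 n) c').source)
    (hφ : MDifferentiableAt (𝓡 n) (𝓡 n) φ x) :
    gramDet g (φ x) (fun i => modelDeriv n φ x (EuclideanSpace.single i (1 : ℝ))) =
      (sqrtDetMetric g c' (extChartAt (𝓡 n) c' (φ x)) *
        (fderiv ℝ (extChartAt (𝓡 n) c' ∘ φ ∘ (extChartAt (𝓡 n) c).symm)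
          (extChartAt (𝓡 n) c x)).det) ^ 2 *
      (modelDeriv n (extChartAt (𝓡 n) c) x).det ^ 2 := by
  rw [gramDet_eq_chart g c' hφx, ← fderiv_chart_comp c c' φ hx hφx hφ, ← mul_pow, mul_assoc]
  congr 2
  exact LinearMap.det_comp (M := EuclideanSpace ℝ (Fin n)) _ _

theorem gramDet_frame_eq_chart (g : Metric n M) (c : M) {x : M}
    (hx : x ∈ (extChartAt (𝓡 n) c).source) :
    gramDet g x (fun i => (EuclideanSpace.single i (1 : ℝ) : EuclideanSpace ℝ (Fin n))) =
      sqrtDetMetric g c (extChartAt (𝓡 n) c x) ^ 2 *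
        (modelDeriv n (extChartAt (𝓡 n) c) x).det ^ 2 := by
  rw [← mul_pow]
  exact gramDet_eq_chart g c hx (ContinuousLinearMap.id ℝ _)

theorem gramDet_frame_pos (g : Metric n M) (x : M) :
    0 < gramDet g x
      (fun i => (EuclideanSpace.single i (1 : ℝ) : EuclideanSpace ℝ (Fin n))) :=
  gramDet_pos g x (ContinuousLinearMap.id ℝ _) Function.injective_id

theorem jacobian_eq_gramDet (g : Metric n M) (φ : M → M) (x : M) : jacobian g φ x =
    Real.sqrt (gramDet g (φ x) (fun i => modelDeriv n φ x (EuclideanSpace.single i (1 : ℝ)))) /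
    Real.sqrt (gramDet g x
      (fun i => (EuclideanSpace.single i (1 : ℝ) : EuclideanSpace ℝ (Fin n)))) := rfl

/-- The determinant of the chart differential at `x` enters both Gram determinants and cancels, so
nothing depends on the frame chosen in the tangent space. The absolute value appears because a Gram
determinant sees only the square of a determinant. -/
theorem jacobian_eq_chart (g : Metric n M) (c c' : M) (φ : M → M) {x : M}
    (hx : x ∈ (extChartAt (𝓡 n) c).source) (hφx : φ x ∈ (extChartAt (𝓡 n) c').source)
    (hφ : MDifferentiableAt (𝓡 n) (𝓡 n) φ x) :
    jacobian g φ x = sqrtDetMetric g c' (extChartAt (𝓡 n) c' (φ x)) *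
      |(fderiv ℝ (extChartAt (𝓡 n) c' ∘ φ ∘ (extChartAt (𝓡 n) c).symm)
          (extChartAt (𝓡 n) c x)).det| / sqrtDetMetric g c (extChartAt (𝓡 n) c x) := by
  have h1 := gramDet_modelDeriv_eq_chart g c c' φ hx hφx hφ
  have h2 := gramDet_frame_eq_chart g c hx
  have h3 := sqrtDetMetric_pos g c ((extChartAt (𝓡 n) c).map_source hx)
  have h4 := sqrtDetMetric_pos g c' ((extChartAt (𝓡 n) c').map_source hφx)
  have h5 := abs_pos.2 (det_modelDeriv_extChartAt_ne_zero c hx)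
  rw [jacobian_eq_gramDet, h1, h2]
  simp only [← mul_pow, Real.sqrt_sq_eq_abs, abs_mul, abs_of_pos h3, abs_of_pos h4]
  field_simp

theorem jacobian_id (g : Metric n M) (x : M) : jacobian g id x = 1 := by
  have h := gramDet_frame_pos g x
  unfold jacobian
  simp only [mfderiv_id, id]
  exact div_self (Real.sqrt_pos.2 h).ne'

end Gram

/-! ### Smoothness of the coordinate expressions of the metric, the field and the flow -/

section Smoothness

set_option linter.unusedSectionVars false

variable {n : ℕ} {M : Type*} [TopologicalSpace M] [ChartedSpace (EuclideanSpace ℝ (Fin n)) M]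
  [IsManifold (𝓡 n) ∞ M]

/-- This is the bridge between smoothness of a section of the tangent bundle and smoothness of its
components in a chart. -/
theorem trivializationAt_snd (c : M) {x : M} (hx : x ∈ (extChartAt (𝓡 n) c).source)
    (v : TangentSpace (𝓡 n) x) :
    (trivializationAt (EuclideanSpace ℝ (Fin n)) (TangentSpace (𝓡 n)) c
      (⟨x, v⟩ : TangentBundle (𝓡 n) M)).2 = modelDeriv n (extChartAt (𝓡 n) c) x v := by
  rw [extChartAt_source] at hx
  have h := TangentBundle.continuousLinearMapAt_trivializationAt (I := 𝓡 n) hx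
  have h2 := DFunLike.congr_fun h v
  refine Eq.trans ?_ h2
  rw [Bundle.Trivialization.continuousLinearMapAt_apply,
    Bundle.Trivialization.coe_linearMapAt_of_mem]
  simpa using hx

theorem mem_trivializationAt_source (c : M) {x : M} (hx : x ∈ (extChartAt (𝓡 n) c).source)
    (v : TangentSpace (𝓡 n) x) : (⟨x, v⟩ : TangentBundle (𝓡 n) M) ∈
    (trivializationAt (EuclideanSpace ℝ (Fin n)) (TangentSpace (𝓡 n)) c).source := by
  rw [Bundle.Trivialization.mem_source]
  simpa using hx

/-- In the trivialization at `c` this section is constant, because the differentials of the chart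
and of its inverse cancel. -/
theorem coordVector_contMDiffOn (c : M) (i : Fin n) :
    ContMDiffOn (𝓡 n) (𝓡 n).tangent ∞
      (fun z => (⟨(extChartAt (𝓡 n) c).symm z, coordVector c z i⟩ : TangentBundle (𝓡 n) M))
      (extChartAt (𝓡 n) c).target := by
  refine (Bundle.Trivialization.contMDiffOn_iff
    (e := trivializationAt (EuclideanSpace ℝ (Fin n)) (TangentSpace (𝓡 n)) c)
    (IB := 𝓡 n) ?_).2 ⟨contMDiffOn_extChartAt_symm c, ?_⟩
  · intro z hz
    exact mem_trivializationAt_source c ((extChartAt (𝓡 n) c).map_target hz) _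
  · refine contMDiffOn_const (c := EuclideanSpace.single i (1 : ℝ)) |>.congr fun z hz => ?_
    rw [trivializationAt_snd c ((extChartAt (𝓡 n) c).map_target hz)]
    exact DFunLike.congr_fun (modelDeriv_comp_symm c hz) _

theorem metric_coordVector_contDiffOn (g : Metric n M) (c : M) (i j : Fin n) :
    ContDiffOn ℝ ∞ (fun z => g.inner ((extChartAt (𝓡 n) c).symm z)
      (coordVector c z i) (coordVector c z j)) (extChartAt (𝓡 n) c).target := by
  rw [← contMDiffOn_iff_contDiffOn]
  intro z hz
  have hb : ContMDiffWithinAt (𝓡 n) (𝓡 n) ∞ (extChartAt (𝓡 n) c).symm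
      (extChartAt (𝓡 n) c).target z := contMDiffOn_extChartAt_symm c z hz
  have : ContMDiffWithinAt (𝓡 n) ((𝓡 n).prod 𝓘(ℝ)) ∞
      (fun z => Bundle.TotalSpace.mk' ℝ (E := Bundle.Trivial M ℝ) ((extChartAt (𝓡 n) c).symm z)
        (g.inner ((extChartAt (𝓡 n) c).symm z) (coordVector c z i) (coordVector c z j)))
        (extChartAt (𝓡 n) c).target z := by
    apply ContMDiffWithinAt.clm_bundle_apply₂ (F₁ := EuclideanSpace ℝ (Fin n))
      (F₂ := EuclideanSpace ℝ (Fin n))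
    · exact ContMDiffAt.comp_contMDiffWithinAt z g.contMDiff.contMDiffAt hb
    · exact coordVector_contMDiffOn c i z hz
    · exact coordVector_contMDiffOn c j z hz
  simp only [Bundle.contMDiffWithinAt_totalSpace] at this
  exact this.2

theorem sqrtDetMetric_contDiffOn (g : Metric n M) (c : M) :
    ContDiffOn ℝ ∞ (sqrtDetMetric g c) (extChartAt (𝓡 n) c).target := by
  refine ContDiffOn.sqrt ?_ fun z hz => (gramDet_coordVector_pos g c hz).ne'
  unfold gramDet
  simp only [Matrix.det_apply, Matrix.of_apply]
  refine ContDiffOn.sum fun σ _ => ContDiffOn.const_smul _ ?_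
  exact contDiffOn_prod fun i _ => metric_coordVector_contDiffOn g c _ _

/-- The representation of the vector field `u` in the chart centred at `c`. -/
def chartField (u : (x : M) → TangentSpace (𝓡 n) x) (c : M) (z : EuclideanSpace ℝ (Fin n)) :
    EuclideanSpace ℝ (Fin n) :=
  modelDeriv n (extChartAt (𝓡 n) c) ((extChartAt (𝓡 n) c).symm z)
    (u ((extChartAt (𝓡 n) c).symm z))

theorem contMDiffOn_prod_extChartAt_symm (J : Set ℝ) (c : M) :
    ContMDiffOn 𝓘(ℝ, ℝ × EuclideanSpace ℝ (Fin n)) (𝓘(ℝ, ℝ).prod (𝓡 n)) ∞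
      (fun p : ℝ × EuclideanSpace ℝ (Fin n) => (p.1, (extChartAt (𝓡 n) c).symm p.2))
      (J ×ˢ (extChartAt (𝓡 n) c).target) := by
  refine ContMDiffOn.prodMk contDiff_fst.contMDiff.contMDiffOn ?_
  exact (contMDiffOn_extChartAt_symm c).comp contDiff_snd.contMDiff.contMDiffOn
    fun p hp => hp.2

theorem chartField_contDiffOn {J : Set ℝ} {u : ℝ → (x : M) → TangentSpace (𝓡 n) x}
    (hu : SmoothTimeDependentField J u) (c : M) :
    ContDiffOn ℝ ∞ (fun p : ℝ × EuclideanSpace ℝ (Fin n) => chartField (u p.1) c p.2)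
      (J ×ˢ (extChartAt (𝓡 n) c).target) := by
  have h1 := hu.comp (contMDiffOn_prod_extChartAt_symm J c) (fun p hp => ⟨hp.1, mem_univ _⟩)
  have h2 := ((Bundle.Trivialization.contMDiffOn_iff
    (e := trivializationAt (EuclideanSpace ℝ (Fin n)) (TangentSpace (𝓡 n)) c)
    (IB := 𝓡 n) (fun p hp => mem_trivializationAt_source c
      ((extChartAt (𝓡 n) c).map_target hp.2) _)).1 h1).2
  refine (contMDiffOn_iff_contDiffOn.1 h2).congr fun p hp => ?_
  exact (trivializationAt_snd c ((extChartAt (𝓡 n) c).map_target hp.2) _).symm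

theorem IsFlow.chart_contDiffWithinAt {J : Set ℝ} {u : ℝ → (x : M) → TangentSpace (𝓡 n) x}
    {η : ℝ → M → M} (hη : IsFlow J u η) (c c' : M) {t : ℝ} {z : EuclideanSpace ℝ (Fin n)}
    (ht : t ∈ J) (hz : z ∈ (extChartAt (𝓡 n) c).target)
    (hc' : η t ((extChartAt (𝓡 n) c).symm z) ∈ (extChartAt (𝓡 n) c').source) :
    ContDiffWithinAt ℝ ∞ (fun p : ℝ × EuclideanSpace ℝ (Fin n) =>
      extChartAt (𝓡 n) c' (η p.1 ((extChartAt (𝓡 n) c).symm p.2)))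
      (J ×ˢ (extChartAt (𝓡 n) c).target) (t, z) := by
  rw [← contMDiffWithinAt_iff_contDiffWithinAt]
  have h1 := hη.smooth.comp (contMDiffOn_prod_extChartAt_symm J c)
    (fun p hp => ⟨hp.1, mem_univ _⟩) (t, z) ⟨ht, hz⟩
  have h2 := contMDiffAt_extChartAt' (I := 𝓡 n) (n := ∞) (x := c')
    (x' := η t ((extChartAt (𝓡 n) c).symm z)) (by simpa using hc')
  exact ContMDiffAt.comp_contMDiffWithinAt (t, z) h2 h1

theorem IsFlow.contMDiff {J : Set ℝ} {u : ℝ → (x : M) → TangentSpace (𝓡 n) x}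
    {η : ℝ → M → M} (hη : IsFlow J u η) {t : ℝ} (ht : t ∈ J) :
    ContMDiff (𝓡 n) (𝓡 n) ∞ (η t) := by
  rw [← contMDiffOn_univ]
  exact hη.smooth.comp (g := fun p : ℝ × M => η p.1 p.2) (f := fun x : M => (t, x))
    (contMDiff_const.prodMk contMDiff_id).contMDiffOn (fun x _ => ⟨ht, mem_univ _⟩)

theorem IsFlow.continuousOn_curve {J : Set ℝ} {u : ℝ → (x : M) → TangentSpace (𝓡 n) x}
    {η : ℝ → M → M} (hη : IsFlow J u η) (x : M) : ContinuousOn (fun t => η t x) J :=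
  fun t ht => (hη.velocity t ht x).continuousWithinAt

theorem IsFlow.chart_hasDerivWithinAt {J : Set ℝ} {u : ℝ → (x : M) → TangentSpace (𝓡 n) x}
    {η : ℝ → M → M} (hη : IsFlow J u η) (c : M) {t : ℝ} (ht : t ∈ J) {x : M}
    (hx : η t x ∈ (extChartAt (𝓡 n) c).source) :
    HasDerivWithinAt (fun s => extChartAt (𝓡 n) c (η s x))
      (chartField (u t) c (extChartAt (𝓡 n) c (η t x))) J t := by
  have h1 : HasMFDerivAt (𝓡 n) (𝓡 n) (extChartAt (𝓡 n) c) (η t x)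
      (mfderiv (𝓡 n) (𝓡 n) (extChartAt (𝓡 n) c) (η t x)) :=
    (mdifferentiableAt_extChartAt (by simpa using hx)).hasMFDerivAt
  have h2 : HasFDerivWithinAt (fun s => extChartAt (𝓡 n) c (η s x))
      ((modelDeriv n (extChartAt (𝓡 n) c) (η t x)) ∘L
        ((1 : ℝ →L[ℝ] ℝ).smulRight (show EuclideanSpace ℝ (Fin n) from u t (η t x)))) J t :=
    (h1.comp_hasMFDerivWithinAt t (hη.velocity t ht x)).hasFDerivWithinAt
  refine h2.hasDerivWithinAt.congr_deriv ?_
  unfold chartField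
  rw [(extChartAt (𝓡 n) c).left_inv hx]
  change modelDeriv n (extChartAt (𝓡 n) c) (η t x) ((1 : ℝ) • (_ : EuclideanSpace ℝ (Fin n))) = _
  rw [one_smul]

end Smoothness

/-! ### Jacobi's and Liouville's formulas in Euclidean space -/

section Liouville

variable {n : ℕ}

theorem det_eq_matrix_det
    (A : EuclideanSpace ℝ (Fin n) →L[ℝ] EuclideanSpace ℝ (Fin n)) :
    A.det = (Matrix.of fun k i => A (EuclideanSpace.single i (1 : ℝ)) k).det := by
  set b := (EuclideanSpace.basisFun (Fin n) ℝ).toBasis with hb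
  refine (LinearMap.det_toMatrix b _).symm.trans ?_
  congr 1

theorem differentiable_det : Differentiable ℝ
    (fun A : EuclideanSpace ℝ (Fin n) →L[ℝ] EuclideanSpace ℝ (Fin n) => A.det) := by
  simp only [det_eq_matrix_det, Matrix.det_apply, Matrix.of_apply]
  refine Differentiable.fun_sum fun σ _ => Differentiable.const_smul ?_ _
  refine (contDiff_prod (n := 1) fun i _ => ?_).differentiable one_ne_zero
  fun_prop

/-- Jacobi's formula, in the only directions needed. From `det (B + s A B) = det (1 + s A) det B`
and `det (1 + s A) = 1 + s tr A + O(s²)` it follows without assuming `B` invertible, so the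
determinant of the flow need not be known to be nonzero beforehand. -/
theorem fderiv_det_apply
    (A B : EuclideanSpace ℝ (Fin n) →L[ℝ] EuclideanSpace ℝ (Fin n)) :
    fderiv ℝ (fun A : EuclideanSpace ℝ (Fin n) →L[ℝ] EuclideanSpace ℝ (Fin n) => A.det) B
      (A ∘L B) = (∑ i, A (EuclideanSpace.single i (1 : ℝ)) i) * B.det := by
  have h1 : HasDerivAt (fun s : ℝ => B + s • (A ∘L B)) (A ∘L B) 0 := by
    simpa using ((hasDerivAt_id (0 : ℝ)).smul_const (A ∘L B)).const_add B
  have h0 : HasFDerivAt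
      (fun A : EuclideanSpace ℝ (Fin n) →L[ℝ] EuclideanSpace ℝ (Fin n) => A.det)
      (fderiv ℝ (fun A : EuclideanSpace ℝ (Fin n) →L[ℝ] EuclideanSpace ℝ (Fin n) => A.det) B)
      (B + (0 : ℝ) • (A ∘L B)) := by
    have h : B + (0 : ℝ) • (A ∘L B) = B :=
      (congrArg (B + ·) (zero_smul ℝ (A ∘L B))).trans (add_zero B)
    rw [h]
    exact (differentiable_det B).hasFDerivAt
  have h2 := h0.comp_hasDerivAt (0 : ℝ) h1
  refine h2.unique ?_
  set m : Matrix (Fin n) (Fin n) ℝ :=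
    Matrix.of fun k i => A (EuclideanSpace.single i (1 : ℝ)) k with hm
  have h3 : ∀ s : ℝ, (B + s • (A ∘L B)).det =
      (1 + m.trace * s + (Matrix.det (1 + (Polynomial.X : Polynomial ℝ) •
        m.map Polynomial.C)).divX.divX.eval s * s ^ 2) * B.det := by
    intro s
    have h4 : B + s • (A ∘L B) = (ContinuousLinearMap.id ℝ _ + s • A) ∘L B := by
      ext1 v; simp
    rw [h4]
    have h5 : ((ContinuousLinearMap.id ℝ _ + s • A) ∘L B).det =
        (ContinuousLinearMap.id ℝ _ + s • A).det * B.det :=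
      LinearMap.det_comp (M := EuclideanSpace ℝ (Fin n)) _ _
    rw [h5, ← Matrix.det_one_add_smul, det_eq_matrix_det]
    congr 2
    ext k i
    simp [hm, Matrix.one_apply]
  have h6 : HasDerivAt (fun s : ℝ => (1 + m.trace * s + (Matrix.det
      (1 + (Polynomial.X : Polynomial ℝ) • m.map Polynomial.C)).divX.divX.eval s * s ^ 2) * B.det)
      (m.trace * B.det) 0 := by
    have h7 := (((hasDerivAt_id (0 : ℝ)).const_mul m.trace).const_add 1).add
      ((Polynomial.hasDerivAt (Matrix.det (1 + (Polynomial.X : Polynomial ℝ) •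
        m.map Polynomial.C)).divX.divX (0 : ℝ)).mul (hasDerivAt_pow 2 (0 : ℝ)))
    refine (h7.mul_const B.det).congr_deriv ?_
    simp
  refine (h6.congr_of_eventuallyEq (Filter.Eventually.of_forall h3)).congr_deriv ?_
  simp [hm, Matrix.trace]

theorem hasDerivWithinAt_det {J : Set ℝ} {t : ℝ}
    {D : ℝ → EuclideanSpace ℝ (Fin n) →L[ℝ] EuclideanSpace ℝ (Fin n)}
    {A : EuclideanSpace ℝ (Fin n) →L[ℝ] EuclideanSpace ℝ (Fin n)}
    (hD : HasDerivWithinAt D (A ∘L D t) J t) :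
    HasDerivWithinAt (fun s => (D s).det)
      ((∑ i, A (EuclideanSpace.single i (1 : ℝ)) i) * (D t).det) J t := by
  rw [← fderiv_det_apply]
  exact (differentiable_det (D t)).hasFDerivAt.comp_hasDerivWithinAt t hD

/-- The derivative of the spatial differential of a time-dependent map with velocity `U`. -/
theorem hasDerivWithinAt_spatial_fderiv {E : Type*} [NormedAddCommGroup E] [NormedSpace ℝ E]
    {J : Set ℝ} {V : Set E} (hJ : UniqueDiffOn ℝ J) (hV : IsOpen V) {t : ℝ} {z : E}
    (ht : t ∈ J) (htc : t ∈ closure (interior J)) (hz : z ∈ V) {F : ℝ × E → E}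
    (hF : ContDiffWithinAt ℝ 2 F (J ×ˢ V) (t, z)) {U : E → E}
    (hU : DifferentiableAt ℝ U (F (t, z)))
    (hv : ∀ᶠ w in nhds z, HasDerivWithinAt (fun s => F (s, w)) (U (F (t, w))) J t) :
    HasDerivWithinAt (fun s => fderiv ℝ (fun w => F (s, w)) z)
      ((fderiv ℝ U (F (t, z))) ∘L (fderiv ℝ (fun w => F (t, w)) z)) J t := by
  have hud : UniqueDiffOn ℝ (J ×ˢ V) := hJ.prod hV.uniqueDiffOn
  have hmem : (t, z) ∈ J ×ˢ V := ⟨ht, hz⟩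
  -- Second derivatives within `J × V` are symmetric even at an end point of `J`, because the point
  -- lies in the closure of the interior.
  have hsymm : IsSymmSndFDerivWithinAt ℝ F (J ×ˢ V) (t, z) := by
    refine hF.isSymmSndFDerivWithinAt (by simp) hud ?_ hmem
    rw [interior_prod_eq, closure_prod_eq]
    exact ⟨htc, subset_closure (by rwa [hV.interior_eq])⟩
  set G := fderivWithin ℝ F (J ×ˢ V) with hG
  have hGd : HasFDerivWithinAt G (fderivWithin ℝ G (J ×ˢ V) (t, z)) (J ×ˢ V) (t, z) :=
    ((hF.fderivWithin_right hud (m := 1) (by norm_num) hmem).differentiableWithinAt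
      one_ne_zero).hasFDerivWithinAt
  set G' := fderivWithin ℝ G (J ×ˢ V) (t, z)
  have hev : ∀ᶠ p in nhdsWithin (t, z) (J ×ˢ V), HasFDerivWithinAt F (G p) (J ×ˢ V) p := by
    have h1 := hF.eventually (by simp)
    rw [insert_eq_of_mem hmem] at h1
    filter_upwards [h1] with p hp
    exact (hp.differentiableWithinAt two_ne_zero).hasFDerivWithinAt
  -- restriction of the spatial derivative to the line `w = z`
  have hline : Filter.Tendsto (fun s : ℝ => (s, z)) (nhdsWithin t J)
      (nhdsWithin (t, z) (J ×ˢ V)) := by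
    refine tendsto_nhdsWithin_of_tendsto_nhds_of_eventually_within _ ?_ ?_
    · exact ((continuous_id.prodMk continuous_const).tendsto' t (t, z) rfl).mono_left
        nhdsWithin_le_nhds
    · filter_upwards [self_mem_nhdsWithin] with s hs using ⟨hs, hz⟩
  have hspace : Filter.Tendsto (fun w : E => (t, w)) (nhds z) (nhdsWithin (t, z) (J ×ˢ V)) := by
    refine tendsto_nhdsWithin_of_tendsto_nhds_of_eventually_within _ ?_ ?_
    · exact (continuous_const.prodMk continuous_id).tendsto' z (t, z) rfl
    · filter_upwards [hV.mem_nhds hz] with w hw using ⟨ht, hw⟩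
  have hslice : ∀ {s : ℝ} {w : E}, s ∈ J → w ∈ V → HasFDerivWithinAt F (G (s, w)) (J ×ˢ V) (s, w) →
      HasFDerivAt (fun w => F (s, w)) ((G (s, w)) ∘L ContinuousLinearMap.inr ℝ ℝ E) w := by
    intro s w hs hw hd
    have h1 : HasFDerivWithinAt (fun w : E => (s, w)) (ContinuousLinearMap.inr ℝ ℝ E) V w :=
      (hasFDerivAt_prodMk_right s w).hasFDerivWithinAt
    exact (hd.comp w h1 (fun y hy => mk_mem_prod hs hy)).hasFDerivAt (hV.mem_nhds hw)
  have hDeq : (fun s => fderiv ℝ (fun w => F (s, w)) z) =ᶠ[nhdsWithin t J]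
      fun s => (G (s, z)) ∘L ContinuousLinearMap.inr ℝ ℝ E := by
    filter_upwards [hline.eventually hev, self_mem_nhdsWithin] with s hs hsJ
    exact (hslice hsJ hz hs).fderiv
  have hFt := hev.self_of_nhdsWithin hmem
  have hDt : fderiv ℝ (fun w => F (t, w)) z = (G (t, z)) ∘L ContinuousLinearMap.inr ℝ ℝ E :=
    (hslice ht hz hFt).fderiv
  have hGline : HasDerivWithinAt (fun s => G (s, z)) (G' (1, 0)) J t := by
    have h1 : HasDerivWithinAt (fun s : ℝ => (s, z)) ((1 : ℝ), (0 : E)) J t :=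
      (hasDerivWithinAt_id t J).prodMk (hasDerivWithinAt_const t J z)
    exact hGd.comp_hasDerivWithinAt t h1 (fun s hs => mk_mem_prod hs hz)
  have hD : HasDerivWithinAt (fun s => (G (s, z)) ∘L ContinuousLinearMap.inr ℝ ℝ E)
      ((G' (1, 0)) ∘L ContinuousLinearMap.inr ℝ ℝ E) J t :=
    (((ContinuousLinearMap.compL ℝ E (ℝ × E) E).flip
      (ContinuousLinearMap.inr ℝ ℝ E)).hasFDerivAt.comp_hasDerivWithinAt t hGline)
  -- Near `z` the velocity `∂ₜF(t,·)` equals `U ∘ F(t,·)`, whose differential is known by the chain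
  -- rule. Symmetry then exchanges the time and space derivatives.
  have hkey : (G' (1, 0)) ∘L ContinuousLinearMap.inr ℝ ℝ E =
      (fderiv ℝ U (F (t, z))) ∘L (fderiv ℝ (fun w => F (t, w)) z) := by
    have h1 : HasFDerivAt (fun w => G (t, w) (1, 0))
        ((ContinuousLinearMap.apply ℝ E ((1 : ℝ), (0 : E))) ∘L
          (G' ∘L ContinuousLinearMap.inr ℝ ℝ E)) z := by
      have h2 : HasFDerivWithinAt (fun w : E => (t, w)) (ContinuousLinearMap.inr ℝ ℝ E) V z :=
        (hasFDerivAt_prodMk_right t z).hasFDerivWithinAt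
      have h3 := (hGd.comp z h2 (fun y hy => mk_mem_prod ht hy)).hasFDerivAt (hV.mem_nhds hz)
      exact (ContinuousLinearMap.apply ℝ E ((1 : ℝ), (0 : E))).hasFDerivAt.comp z h3
    have h4 : HasFDerivAt (fun w => U (F (t, w)))
        ((fderiv ℝ U (F (t, z))) ∘L (fderiv ℝ (fun w => F (t, w)) z)) z := by
      rw [hDt]
      exact hU.hasFDerivAt.comp z (hslice ht hz hFt)
    have h5 : (fun w => U (F (t, w))) =ᶠ[nhds z] fun w => G (t, w) (1, 0) := by
      filter_upwards [hv, hspace.eventually hev, hV.mem_nhds hz] with w hw hw2 hwV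
      have h6 : HasDerivWithinAt (fun s : ℝ => (s, w)) ((1 : ℝ), (0 : E)) J t :=
        (hasDerivWithinAt_id t J).prodMk (hasDerivWithinAt_const t J w)
      have h7 := hw2.comp_hasDerivWithinAt t h6 (fun s hs => mk_mem_prod hs hwV)
      exact (hJ t ht).eq_deriv _ hw h7
    rw [h4.unique (h1.congr_of_eventuallyEq h5)]
    ext1 w
    exact hsymm _ _
  rw [← hkey]
  exact hD.congr_of_eventuallyEq hDeq (hDeq.self_of_nhdsWithin ht)

/-- Liouville's formula: `S` times the spatial Jacobian determinant of a time-dependent map with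
velocity `U` has logarithmic derivative `S⁻¹ ∑ᵢ ∂ᵢ (S Uⁱ)`. -/
theorem hasDerivWithinAt_density_mul_det
    {J : Set ℝ} {V : Set (EuclideanSpace ℝ (Fin n))} (hJ : UniqueDiffOn ℝ J) (hV : IsOpen V)
    {t : ℝ} {z : EuclideanSpace ℝ (Fin n)}
    (ht : t ∈ J) (htc : t ∈ closure (interior J)) (hz : z ∈ V)
    {F : ℝ × EuclideanSpace ℝ (Fin n) → EuclideanSpace ℝ (Fin n)}
    (hF : ContDiffWithinAt ℝ 2 F (J ×ˢ V) (t, z))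
    {U : EuclideanSpace ℝ (Fin n) → EuclideanSpace ℝ (Fin n)}
    {S : EuclideanSpace ℝ (Fin n) → ℝ}
    (hU : DifferentiableAt ℝ U (F (t, z))) (hS : DifferentiableAt ℝ S (F (t, z)))
    (hv : ∀ᶠ w in nhds z, HasDerivWithinAt (fun s => F (s, w)) (U (F (t, w))) J t) :
    HasDerivWithinAt (fun s => S (F (s, z)) * (fderiv ℝ (fun w => F (s, w)) z).det)
      ((∑ i, fderiv ℝ (fun w => S w * U w i) (F (t, z)) (EuclideanSpace.single i (1 : ℝ))) *
        (fderiv ℝ (fun w => F (t, w)) z).det) J t := by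
  have h1 := hasDerivWithinAt_det (hasDerivWithinAt_spatial_fderiv hJ hV ht htc hz hF hU hv)
  have h2 : HasDerivWithinAt (fun s => S (F (s, z))) (fderiv ℝ S (F (t, z)) (U (F (t, z)))) J t :=
    hS.hasFDerivAt.comp_hasDerivWithinAt t hv.self_of_nhds
  refine (h2.mul h1).congr_deriv ?_
  -- Summed over `i`, this reads `∑ ∂ᵢ(S Uⁱ) = S tr DU + dS(U)`: the first term comes from the
  -- determinant, the second from moving the base point of `S`.
  have h3 : ∀ i, fderiv ℝ (fun w => S w * U w i) (F (t, z)) (EuclideanSpace.single i (1 : ℝ)) =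
      S (F (t, z)) * fderiv ℝ U (F (t, z)) (EuclideanSpace.single i (1 : ℝ)) i +
      U (F (t, z)) i * fderiv ℝ S (F (t, z)) (EuclideanSpace.single i (1 : ℝ)) := by
    intro i
    have h4 : HasFDerivAt (fun w => U w i)
        ((EuclideanSpace.proj (𝕜 := ℝ) i) ∘L (fderiv ℝ U (F (t, z)))) (F (t, z)) :=
      (EuclideanSpace.proj (𝕜 := ℝ) i).hasFDerivAt.comp (F (t, z))
        hU.hasFDerivAt
    refine (DFunLike.congr_fun (hS.hasFDerivAt.mul h4).fderiv _).trans ?_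
    simp
  have h5 : fderiv ℝ S (F (t, z)) (U (F (t, z))) =
      ∑ i, U (F (t, z)) i * fderiv ℝ S (F (t, z)) (EuclideanSpace.single i (1 : ℝ)) := by
    have h6 := (EuclideanSpace.basisFun (Fin n) ℝ).sum_repr (U (F (t, z)))
    simp only [EuclideanSpace.basisFun_repr, EuclideanSpace.basisFun_apply] at h6
    conv_lhs => rw [← h6]
    simp
  simp only [h3, Finset.sum_add_distrib, ← Finset.mul_sum, ← h5]
  ring

end Liouville

/-! ### Independence of the divergence from the chart, and its smoothness -/

section ChartDivergence

set_option linter.unusedSectionVars false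

variable {n : ℕ} {M : Type*} [TopologicalSpace M] [ChartedSpace (EuclideanSpace ℝ (Fin n)) M]
  [IsManifold (𝓡 n) ∞ M]

/-- The coordinate expression of the divergence in the chart centred at `c`. -/
def chartDiv (g : Metric n M) (u : (x : M) → TangentSpace (𝓡 n) x) (c : M)
    (z : EuclideanSpace ℝ (Fin n)) : ℝ :=
  (∑ i : Fin n, fderiv ℝ (fun w => sqrtDetMetric g c w * chartField u c w i) z
    (EuclideanSpace.single i (1 : ℝ))) / sqrtDetMetric g c z

theorem divergence_eq_chartDiv_self (g : Metric n M) (u : (x : M) → TangentSpace (𝓡 n) x)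
    (x : M) : divergence g u x = chartDiv g u x (extChartAt (𝓡 n) x x) := rfl

theorem eventually_mem_chart_overlap (c c' : M) {z : EuclideanSpace ℝ (Fin n)}
    (hz : z ∈ (extChartAt (𝓡 n) c).target)
    (hz' : (extChartAt (𝓡 n) c).symm z ∈ (extChartAt (𝓡 n) c').source) :
    ∀ᶠ w in nhds z, w ∈ (extChartAt (𝓡 n) c).target ∧
      (extChartAt (𝓡 n) c).symm w ∈ (extChartAt (𝓡 n) c').source := by
  refine ((isOpen_extChartAt_target c).mem_nhds hz |> fun h => ?_)
  have h2 : ContinuousAt (extChartAt (𝓡 n) c).symm z :=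
    (continuousOn_extChartAt_symm c).continuousAt h
  exact (Filter.Eventually.and h (h2.eventually ((isOpen_extChartAt_source c').mem_nhds hz')))

/-- The change of coordinates between two charts. -/
def transition (c c' : M) : EuclideanSpace ℝ (Fin n) → EuclideanSpace ℝ (Fin n) :=
  extChartAt (𝓡 n) c' ∘ id ∘ (extChartAt (𝓡 n) c).symm

theorem transition_contDiffAt (c c' : M) {z : EuclideanSpace ℝ (Fin n)}
    (hz : z ∈ (extChartAt (𝓡 n) c).target)
    (hz' : (extChartAt (𝓡 n) c).symm z ∈ (extChartAt (𝓡 n) c').source) :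
    ContDiffAt ℝ ∞ (transition c c' : EuclideanSpace ℝ (Fin n) → _) z := by
  rw [← contMDiffAt_iff_contDiffAt]
  have h1 : ContMDiffAt (𝓡 n) (𝓡 n) ∞ (extChartAt (𝓡 n) c).symm z :=
    (contMDiffOn_extChartAt_symm c).contMDiffAt ((isOpen_extChartAt_target c).mem_nhds hz)
  have h2 := contMDiffAt_extChartAt' (I := 𝓡 n) (n := ∞) (x := c')
    (x' := (extChartAt (𝓡 n) c).symm z) (by simpa using hz')
  exact h2.comp z h1

theorem sqrtDetMetric_transition (g : Metric n M) (c c' : M) {z : EuclideanSpace ℝ (Fin n)}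
    (hz : z ∈ (extChartAt (𝓡 n) c).target)
    (hz' : (extChartAt (𝓡 n) c).symm z ∈ (extChartAt (𝓡 n) c').source) :
    sqrtDetMetric g c' (transition c c' z) * |(fderiv ℝ (transition c c') z).det| =
      sqrtDetMetric g c z := by
  have h := jacobian_eq_chart g c c' id ((extChartAt (𝓡 n) c).map_target hz) hz'
    mdifferentiableAt_id
  rw [jacobian_id, (extChartAt (𝓡 n) c).right_inv hz] at h
  have h2 := sqrtDetMetric_pos g c hz
  exact ((div_eq_one_iff_eq h2.ne').1 h.symm)

theorem chartField_transition (u : (x : M) → TangentSpace (𝓡 n) x) (c c' : M)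
    {z : EuclideanSpace ℝ (Fin n)} (hz : z ∈ (extChartAt (𝓡 n) c).target)
    (hz' : (extChartAt (𝓡 n) c).symm z ∈ (extChartAt (𝓡 n) c').source) :
    chartField u c' (transition c c' z) = fderiv ℝ (transition c c') z (chartField u c z) := by
  have h := fderiv_chart_comp c c' id ((extChartAt (𝓡 n) c).map_target hz) hz'
    mdifferentiableAt_id
  rw [(extChartAt (𝓡 n) c).right_inv hz] at h
  have h2 := DFunLike.congr_fun h (u ((extChartAt (𝓡 n) c).symm z))
  refine Eq.trans ?_ h2.symm
  have h3 : (extChartAt (𝓡 n) c').symm (transition c c' z) = (extChartAt (𝓡 n) c).symm z :=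
    (extChartAt (𝓡 n) c').left_inv hz'
  have h4 : modelDeriv n (id : M → M) ((extChartAt (𝓡 n) c).symm z) =
      ContinuousLinearMap.id ℝ _ := mfderiv_id
  simp only [id]
  rw [h4]
  unfold chartField
  rw [h3]
  rfl

/-- The coordinate expression of the divergence does not depend on the chart. -/
theorem chartDiv_transition (g : Metric n M) (u : (x : M) → TangentSpace (𝓡 n) x)
    (hu : ∀ c, ContDiffOn ℝ ∞ (chartField u c) (extChartAt (𝓡 n) c).target) (c c' : M)
    {z : EuclideanSpace ℝ (Fin n)} (hz : z ∈ (extChartAt (𝓡 n) c).target)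
    (hz' : (extChartAt (𝓡 n) c).symm z ∈ (extChartAt (𝓡 n) c').source) :
    chartDiv g u c z = chartDiv g u c' (transition c c' z) := by
  set τ : EuclideanSpace ℝ (Fin n) → EuclideanSpace ℝ (Fin n) := transition c c' with hτ
  set U := chartField u c with hU
  set S := sqrtDetMetric g c with hS
  set U' := chartField u c' with hU'
  set S' := sqrtDetMetric g c' with hS'
  have hzt : τ z ∈ (extChartAt (𝓡 n) c').target := (extChartAt (𝓡 n) c').map_source hz'
  have hUz : ContDiffAt ℝ ∞ U z := (hu c).contDiffAt ((isOpen_extChartAt_target c).mem_nhds hz)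
  have hSz : ContDiffAt ℝ ∞ S z :=
    (sqrtDetMetric_contDiffOn g c).contDiffAt ((isOpen_extChartAt_target c).mem_nhds hz)
  have hUz' : ContDiffAt ℝ ∞ U' (τ z) :=
    (hu c').contDiffAt ((isOpen_extChartAt_target c').mem_nhds hzt)
  have hSz' : ContDiffAt ℝ ∞ S' (τ z) :=
    (sqrtDetMetric_contDiffOn g c').contDiffAt ((isOpen_extChartAt_target c').mem_nhds hzt)
  have hW := eventually_mem_chart_overlap c c' hz hz'
  have hτd : ∀ᶠ w in nhds z, DifferentiableAt ℝ τ w := by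
    filter_upwards [hW] with w hw
    exact (transition_contDiffAt c c' hw.1 hw.2).differentiableAt (by simp)
  -- Only the velocity at time `0` matters, so straight-line motion replaces the flow of the field.
  -- Liouville's formula is applied to it in the chart at `c` and to its image in the chart at `c'`;
  -- both compute the derivative of the same volume density.
  set F : ℝ × EuclideanSpace ℝ (Fin n) → EuclideanSpace ℝ (Fin n) :=
    fun p => p.2 + p.1 • U p.2 with hF
  have hF0 : ∀ w, F (0, w) = w := fun w => by simp [hF]
  have hFc : ContDiffAt ℝ ∞ F (0, z) := by
    have h1 : ContDiffAt ℝ ∞ (fun p : ℝ × EuclideanSpace ℝ (Fin n) => U p.2) (0, z) :=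
      hUz.comp (0, z) contDiffAt_snd
    exact contDiffAt_snd.add (contDiffAt_fst.smul h1)
  have hFt : Filter.Tendsto (fun s : ℝ => F (s, z)) (nhds 0) (nhds z) := by
    have h1 : Continuous (fun s : ℝ => F (s, z)) := by
      simp only [hF]; fun_prop
    exact h1.tendsto' 0 z (hF0 z)
  have hvF : ∀ w, HasDerivWithinAt (fun s => F (s, w)) (U (F (0, w))) univ 0 := by
    intro w
    rw [hF0]
    have := ((hasDerivAt_id (0 : ℝ)).smul_const (U w)).const_add w
    simpa [hF] using this
  have htau : ContDiffAt ℝ ∞ τ z := transition_contDiffAt c c' hz hz'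
  have h1 := hasDerivWithinAt_density_mul_det (n := n) (J := univ) (V := univ) uniqueDiffOn_univ
    isOpen_univ (t := 0) (z := z) (mem_univ _) (by simp) (mem_univ _) (F := F)
    (hFc.of_le ENat.LEInfty.out).contDiffWithinAt (U := U) (S := S)
    (by rw [hF0]; exact hUz.differentiableAt (by simp))
    (by rw [hF0]; exact hSz.differentiableAt (by simp)) (Filter.Eventually.of_forall hvF)
  have h2 := hasDerivWithinAt_density_mul_det (n := n) (J := univ) (V := univ) uniqueDiffOn_univ
    isOpen_univ (t := 0) (z := z) (mem_univ _) (by simp) (mem_univ _) (F := fun p => τ (F p))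
    ((ContDiffAt.comp (0, z) (by rw [hF0]; exact htau) hFc).of_le
      ENat.LEInfty.out).contDiffWithinAt (U := U') (S := S')
    (by rw [hF0]; exact hUz'.differentiableAt (by simp))
    (by rw [hF0]; exact hSz'.differentiableAt (by simp)) (by
      filter_upwards [hτd, hW] with w hw hw2
      have e := chartField_transition u c c' hw2.1 hw2.2
      rw [hF0]
      change HasDerivWithinAt _ (chartField u c' (transition c c' w)) _ _
      rw [e]
      have h3 := hvF w
      rw [hF0] at h3
      have hw' : HasFDerivAt τ (fderiv ℝ τ w) (F (0, w)) := by rw [hF0]; exact hw.hasFDerivAt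
      exact hw'.comp_hasDerivWithinAt 0 h3)
  rw [hasDerivWithinAt_univ] at h1 h2
  -- The change of charts may reverse orientation, and only `|det|` is controlled by
  -- `sqrtDetMetric_transition`; squares remove the sign.
  have h3 := h1.pow 2
  have h4 := h2.pow 2
  have heq : (fun s => S' (τ (F (s, z))) * (fderiv ℝ (fun w => τ (F (s, w))) z).det) ^ 2
      =ᶠ[nhds 0] (fun s => S (F (s, z)) * (fderiv ℝ (fun w => F (s, w)) z).det) ^ 2 := by
    filter_upwards [hFt.eventually hτd, hFt.eventually hW] with s hs hs2
    have hd : DifferentiableAt ℝ (fun w => F (s, w)) z := by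
      have := hUz.differentiableAt (by simp)
      simp only [hF]; fun_prop
    have h5 : fderiv ℝ (fun w => τ (F (s, w))) z =
        (fderiv ℝ τ (F (s, z))) ∘L (fderiv ℝ (fun w => F (s, w)) z) :=
      (HasFDerivAt.comp (g := τ) (f := fun w => F (s, w)) z hs.hasFDerivAt hd.hasFDerivAt).fderiv
    have h6 : ((fderiv ℝ τ (F (s, z))) ∘L (fderiv ℝ (fun w => F (s, w)) z)).det =
        (fderiv ℝ τ (F (s, z))).det * (fderiv ℝ (fun w => F (s, w)) z).det :=
      LinearMap.det_comp (M := EuclideanSpace ℝ (Fin n)) _ _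
    have h7 := sqrtDetMetric_transition g c c' hs2.1 hs2.2
    simp only [Pi.pow_apply]
    rw [h5, h6, hS, ← h7, mul_pow, mul_pow, mul_pow, mul_pow, sq_abs]
    ring
  have h5 := (h3.congr_of_eventuallyEq heq).unique h4
  have e1 : (fderiv ℝ (fun w => F (0, w)) z).det = 1 := by
    have : (fun w => F (0, w)) = id := funext hF0
    rw [this, fderiv_id]
    exact LinearMap.det_id
  have e2 : fderiv ℝ (fun w => τ (F (0, w))) z = fderiv ℝ τ z := by
    have : (fun w => τ (F (0, w))) = τ := funext fun w => by rw [hF0]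
    rw [this]
  rw [e1, e2] at h5
  simp only [hF0, mul_one] at h5
  have h6 : (S' (τ z) * (fderiv ℝ τ z).det) ^ 2 = S z ^ 2 := by
    rw [mul_pow, ← sq_abs (fderiv ℝ τ z).det, ← mul_pow]
    exact congrArg (· ^ 2) (sqrtDetMetric_transition g c c' hz hz')
  have hpos : 0 < S z := sqrtDetMetric_pos g c hz
  have hpos' : 0 < S' (τ z) := sqrtDetMetric_pos g c' hzt
  unfold chartDiv
  change _ / S z = _ / S' (τ z)
  rw [div_eq_div_iff hpos.ne' hpos'.ne']
  set N := ∑ i, fderiv ℝ (fun w => S w * U w i) z (EuclideanSpace.single i (1 : ℝ))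
  set N' := ∑ i, fderiv ℝ (fun w => S' w * U' w i) (τ z) (EuclideanSpace.single i (1 : ℝ))
  set d := (fderiv ℝ τ z).det
  have h7 : S z * N = S' (τ z) * d ^ 2 * N' := by
    norm_num at h5
    linarith
  refine mul_left_cancel₀ hpos.ne' ?_
  calc S z * (N * S' (τ z)) = (S z * N) * S' (τ z) := by ring
    _ = (S' (τ z) * d) ^ 2 * N' := by rw [h7]; ring
    _ = S z * (N' * S z) := by rw [h6]; ring

theorem divergence_eq_chartDiv (g : Metric n M) (u : (x : M) → TangentSpace (𝓡 n) x)
    (hu : ∀ c, ContDiffOn ℝ ∞ (chartField u c) (extChartAt (𝓡 n) c).target) (c : M) {x : M}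
    (hx : x ∈ (extChartAt (𝓡 n) c).source) :
    divergence g u x = chartDiv g u c (extChartAt (𝓡 n) c x) := by
  have h := chartDiv_transition g u hu x c (mem_extChartAt_target x)
    (by rwa [extChartAt_to_inv])
  rw [divergence_eq_chartDiv_self, h]
  simp only [transition, Function.comp, extChartAt_to_inv, id]

theorem SmoothTimeDependentField.chartField_contDiffOn_slice {J : Set ℝ}
    {u : ℝ → (x : M) → TangentSpace (𝓡 n) x} (hu : SmoothTimeDependentField J u) {t : ℝ}
    (ht : t ∈ J) (c : M) : ContDiffOn ℝ ∞ (chartField (u t) c) (extChartAt (𝓡 n) c).target :=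
  (chartField_contDiffOn hu c).comp (f := fun z : EuclideanSpace ℝ (Fin n) => (t, z))
    (contDiff_const.prodMk contDiff_id).contDiffOn fun _ hz => mk_mem_prod ht hz

theorem chartDiv_contDiffOn (g : Metric n M) {J : Set ℝ} (hJ : UniqueDiffOn ℝ J)
    {u : ℝ → (x : M) → TangentSpace (𝓡 n) x} (hu : SmoothTimeDependentField J u) (c : M) :
    ContDiffOn ℝ ∞ (fun p : ℝ × EuclideanSpace ℝ (Fin n) => chartDiv g (u p.1) c p.2)
      (J ×ˢ (extChartAt (𝓡 n) c).target) := by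
  set V := (extChartAt (𝓡 n) c).target
  have hV : IsOpen V := isOpen_extChartAt_target c
  have hS : ContDiffOn ℝ ∞ (fun p : ℝ × EuclideanSpace ℝ (Fin n) => sqrtDetMetric g c p.2)
      (J ×ˢ V) := (sqrtDetMetric_contDiffOn g c).comp contDiff_snd.contDiffOn fun p hp => hp.2
  have hud : UniqueDiffOn ℝ (J ×ˢ V) := hJ.prod hV.uniqueDiffOn
  unfold chartDiv
  refine ContDiffOn.div (ContDiffOn.sum fun i _ => ?_) hS
    fun p hp => (sqrtDetMetric_pos g c hp.2).ne'
  have hU : ContDiffOn ℝ ∞ (fun p : ℝ × EuclideanSpace ℝ (Fin n) => chartField (u p.1) c p.2 i)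
      (J ×ˢ V) :=
    (EuclideanSpace.proj (𝕜 := ℝ) i).contDiff.comp_contDiffOn (chartField_contDiffOn hu c)
  have hf := hS.mul hU
  -- The spatial partial derivative is the joint derivative in the direction `(0, eᵢ)`, which gives
  -- smoothness jointly in time and space up to the end points of `J`.
  have hf' := (hf.fderivWithin hud (m := ∞) (by simp)).clm_apply
    (contDiffOn_const (c := ((0 : ℝ), EuclideanSpace.single i (1 : ℝ))))
  refine hf'.congr fun p hp => ?_
  have h1 := (hf.differentiableOn (by simp) p hp).hasFDerivWithinAt
  have h2 : HasFDerivWithinAt (fun w : EuclideanSpace ℝ (Fin n) => (p.1, w))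
      (ContinuousLinearMap.inr ℝ ℝ _) V p.2 := (hasFDerivAt_prodMk_right p.1 p.2).hasFDerivWithinAt
  have h3 := (h1.comp (x := p.2) h2 (fun y hy => mk_mem_prod hp.1 hy)).hasFDerivAt
    (hV.mem_nhds hp.2)
  exact DFunLike.congr_fun h3.fderiv _

end ChartDivergence

/-! ### Calculus and linear equations on an interval -/

section IntervalODE

theorem nonempty_interior_of_ordConnected {J : Set ℝ} (hJ : J.OrdConnected)
    (hn : J.Nontrivial) : (interior J).Nonempty := by
  obtain ⟨a, ha, b, hb, hab⟩ := hn.exists_lt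
  exact (nonempty_Ioo.2 hab).mono
    (interior_Icc.symm.subset.trans (interior_mono (hJ.out ha hb)))

theorem uniqueDiffOn_of_ordConnected {J : Set ℝ} (hJ : J.OrdConnected)
    (hn : J.Nontrivial) : UniqueDiffOn ℝ J :=
  uniqueDiffOn_convex hJ.convex (nonempty_interior_of_ordConnected hJ hn)

theorem subset_closure_interior_of_ordConnected {J : Set ℝ} (hJ : J.OrdConnected)
    (hn : J.Nontrivial) : J ⊆ closure (interior J) := by
  rw [(hJ.convex : Convex ℝ J).closure_interior_eq_closure_of_nonempty_interior
    (nonempty_interior_of_ordConnected hJ hn)]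
  exact subset_closure

theorem hasDerivWithinAt_Iic_of_subset {E : Type*} [NormedAddCommGroup E] [NormedSpace ℝ E]
    {J : Set ℝ} {f : ℝ → E} {f' : E} {a t : ℝ} (h : HasDerivWithinAt f f' J t) (hat : a < t)
    (hJ : Icc a t ⊆ J) : HasDerivWithinAt f f' (Iic t) t :=
  h.mono_of_mem_nhdsWithin (Filter.mem_of_superset (Icc_mem_nhdsLE hat) hJ)

theorem hasDerivWithinAt_Ici_of_subset {E : Type*} [NormedAddCommGroup E] [NormedSpace ℝ E]
    {J : Set ℝ} {f : ℝ → E} {f' : E} {b t : ℝ} (h : HasDerivWithinAt f f' J t) (htb : t < b)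
    (hJ : Icc t b ⊆ J) : HasDerivWithinAt f f' (Ici t) t :=
  h.mono_of_mem_nhdsWithin (Filter.mem_of_superset (Icc_mem_nhdsGE htb) hJ)

/-- A solution of a scalar linear equation on an interval vanishes everywhere or nowhere. -/
theorem ne_zero_of_linear_ode {J : Set ℝ} (hJ : J.OrdConnected) {a f : ℝ → ℝ}
    (ha : ContinuousOn a J) (hf : ∀ t ∈ J, HasDerivWithinAt f (a t * f t) J t)
    {s t : ℝ} (hs : s ∈ J) (ht : t ∈ J) (h0 : f s ≠ 0) : f t ≠ 0 := by
  intro hft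
  have hcont : ContinuousOn f J := fun r hr => (hf r hr).continuousWithinAt
  rcases le_total s t with hst | hst
  · have hsub : Icc s t ⊆ J := hJ.out hs ht
    obtain ⟨K, hK⟩ := isCompact_Icc.exists_bound_of_continuousOn (ha.mono hsub)
    have hlip : ∀ r ∈ Ioc s t, LipschitzOnWith K.toNNReal (fun x => a r * x) univ := by
      intro r hr
      refine LipschitzOnWith.of_dist_le_mul fun x _ y _ => ?_
      rw [Real.dist_eq, Real.dist_eq, ← mul_sub, abs_mul]
      exact mul_le_mul_of_nonneg_right ((hK r (Ioc_subset_Icc_self hr)).trans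
        (Real.le_coe_toNNReal K)) (abs_nonneg _)
    -- The zero function solves the same equation and agrees with `f` at `t`; uniqueness backwards
    -- in time contradicts `f s ≠ 0`.
    have := ODE_solution_unique_of_mem_Icc_left (v := fun r x => a r * x) (s := fun _ => univ)
      (f := f) (g := fun _ => 0) hlip (hcont.mono hsub)
      (fun r hr => hasDerivWithinAt_Iic_of_subset (hf r (hsub (Ioc_subset_Icc_self hr))) hr.1
        ((Icc_subset_Icc_right hr.2).trans hsub))
      (fun _ _ => mem_univ _) continuousOn_const
      (fun r _ => by simpa using hasDerivWithinAt_const r (Iic r) (0 : ℝ))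
      (fun _ _ => mem_univ _) hft
    exact h0 (this ⟨le_rfl, hst⟩)
  · have hsub : Icc t s ⊆ J := hJ.out ht hs
    obtain ⟨K, hK⟩ := isCompact_Icc.exists_bound_of_continuousOn (ha.mono hsub)
    have hlip : ∀ r ∈ Ico t s, LipschitzOnWith K.toNNReal (fun x => a r * x) univ := by
      intro r hr
      refine LipschitzOnWith.of_dist_le_mul fun x _ y _ => ?_
      rw [Real.dist_eq, Real.dist_eq, ← mul_sub, abs_mul]
      exact mul_le_mul_of_nonneg_right ((hK r (Ico_subset_Icc_self hr)).trans
        (Real.le_coe_toNNReal K)) (abs_nonneg _)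
    have := ODE_solution_unique_of_mem_Icc_right (v := fun r x => a r * x) (s := fun _ => univ)
      (f := f) (g := fun _ => 0) hlip (hcont.mono hsub)
      (fun r hr => hasDerivWithinAt_Ici_of_subset (hf r (hsub (Ico_subset_Icc_self hr))) hr.2
        ((Icc_subset_Icc_left hr.1).trans hsub))
      (fun _ _ => mem_univ _) continuousOn_const
      (fun r _ => by simpa using hasDerivWithinAt_const r (Ici r) (0 : ℝ))
      (fun _ _ => mem_univ _) hft
    exact h0 (this ⟨hst, le_rfl⟩)

end IntervalODE

/-! ### Volume and divergence along trajectories -/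

section Flow

set_option linter.unusedSectionVars false

variable {n : ℕ} {M : Type*} [TopologicalSpace M] [ChartedSpace (EuclideanSpace ℝ (Fin n)) M]
  [IsManifold (𝓡 n) ∞ M] {g : Metric n M} {J : Set ℝ}
  {u : ℝ → (x : M) → TangentSpace (𝓡 n) x} {η : ℝ → M → M} {h : ℝ → M → ℝ}

/-- The Gram determinant of the image of the standard frame at `x` under the flow. -/
def flowGram (g : Metric n M) (η : ℝ → M → M) (x : M) (t : ℝ) : ℝ :=
  gramDet g (η t x) (fun i => modelDeriv n (η t) x (EuclideanSpace.single i (1 : ℝ)))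

/-- In the charts centred at `x` and at `η t x`, the Gram determinant is the square of density times
spatial determinant, times a factor independent of time. Liouville's formula says that the unsquared
quantity grows at the rate of the divergence, and squaring doubles the rate. The Gram determinant is
used before the Jacobian because it can be differentiated without knowing that it is positive. -/
theorem flowGram_hasDerivWithinAt (hJ : J.OrdConnected) (hn : J.Nontrivial)
    (hu : SmoothTimeDependentField J u) (hη : IsFlow J u η) {t : ℝ} (ht : t ∈ J) (x : M) :
    HasDerivWithinAt (flowGram g η x)
      (2 * divergence g (u t) (η t x) * flowGram g η x t) J t := by
  set c' := η t x with hc'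
  set V := (extChartAt (𝓡 n) x).target with hV
  set z := extChartAt (𝓡 n) x x with hz
  have hVo : IsOpen V := isOpen_extChartAt_target x
  have hzV : z ∈ V := mem_extChartAt_target x
  have hxz : (extChartAt (𝓡 n) x).symm z = x := extChartAt_to_inv x
  set F : ℝ × EuclideanSpace ℝ (Fin n) → EuclideanSpace ℝ (Fin n) :=
    fun p => extChartAt (𝓡 n) c' (η p.1 ((extChartAt (𝓡 n) x).symm p.2)) with hF
  have hsrc : η t ((extChartAt (𝓡 n) x).symm z) ∈ (extChartAt (𝓡 n) c').source := by
    rw [hxz]; exact mem_extChartAt_source _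
  have hFtz : F (t, z) = extChartAt (𝓡 n) c' c' := by simp only [hF, hxz, ← hc']
  have hFt : F (t, z) ∈ (extChartAt (𝓡 n) c').target := by
    rw [hFtz]; exact mem_extChartAt_target _
  have hnb := (isOpen_extChartAt_target (I := 𝓡 n) c').mem_nhds hFt
  have hcs : ∀ᶠ w in nhds z, η t ((extChartAt (𝓡 n) x).symm w) ∈ (extChartAt (𝓡 n) c').source := by
    have h1 : ContinuousAt (fun w => η t ((extChartAt (𝓡 n) x).symm w)) z :=
      (hη.contMDiff ht).continuous.continuousAt.comp
        ((continuousOn_extChartAt_symm x).continuousAt (hVo.mem_nhds hzV))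
    exact h1.eventually ((isOpen_extChartAt_source c').mem_nhds hsrc)
  have hL := hasDerivWithinAt_density_mul_det (uniqueDiffOn_of_ordConnected hJ hn) hVo ht
    (subset_closure_interior_of_ordConnected hJ hn ht) hzV (F := F)
    ((hη.chart_contDiffWithinAt x c' ht hzV hsrc).of_le ENat.LEInfty.out)
    (U := chartField (u t) c') (S := sqrtDetMetric g c')
    (((hu.chartField_contDiffOn_slice ht c').contDiffAt hnb).differentiableAt (by simp))
    (((sqrtDetMetric_contDiffOn g c').contDiffAt hnb).differentiableAt (by simp))
    (by
      filter_upwards [hcs] with w hw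
      exact hη.chart_hasDerivWithinAt c' ht hw)
  have hL2 := (hL.pow 2).mul_const ((modelDeriv n (extChartAt (𝓡 n) x) x).det ^ 2)
  have hev : ∀ᶠ s in nhdsWithin t J, η s x ∈ (extChartAt (𝓡 n) c').source :=
    (hη.continuousOn_curve x t ht).eventually
      ((isOpen_extChartAt_source c').mem_nhds (mem_extChartAt_source (I := 𝓡 n) c'))
  have heq : ∀ s ∈ J, η s x ∈ (extChartAt (𝓡 n) c').source → flowGram g η x s =
      (sqrtDetMetric g c' (F (s, z)) * (fderiv ℝ (fun w => F (s, w)) z).det) ^ 2 *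
        (modelDeriv n (extChartAt (𝓡 n) x) x).det ^ 2 := by
    intro s hs hsx
    have h1 := gramDet_modelDeriv_eq_chart g x c' (η s) (mem_extChartAt_source x) hsx
      ((hη.contMDiff hs).mdifferentiableAt (by simp))
    simp only [hF, hxz]
    exact h1
  have hgt := heq t ht (mem_extChartAt_source (I := 𝓡 n) c')
  have hD := hL2.congr_of_eventuallyEq (f₁ := flowGram g η x) (by
    filter_upwards [hev, self_mem_nhdsWithin] with s hs hsJ
    exact heq s hsJ hs) hgt
  refine hD.congr_deriv ?_
  rw [hgt, divergence_eq_chartDiv_self, ← hFtz]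
  unfold chartDiv
  have hpos := sqrtDetMetric_pos g c' hFt
  rw [mul_div_assoc', div_mul_eq_mul_div, eq_div_iff hpos.ne']
  push_cast
  ring

theorem flowGram_zero (hη : IsFlow J u η) (x : M) : flowGram g η x 0 =
    gramDet g x (fun i => (EuclideanSpace.single i (1 : ℝ) : EuclideanSpace ℝ (Fin n))) := by
  have h0 : η 0 = id := funext hη.initial
  have h1 : modelDeriv n (id : M → M) x = ContinuousLinearMap.id ℝ _ := mfderiv_id
  unfold flowGram
  rw [h0, h1]
  rfl

theorem flowGram_nonneg (hη : IsFlow J u η) {t : ℝ} (ht : t ∈ J) (x : M) :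
    0 ≤ flowGram g η x t := by
  have h1 := gramDet_modelDeriv_eq_chart g x (η t x) (η t) (mem_extChartAt_source x)
      (mem_extChartAt_source _) ((hη.contMDiff ht).mdifferentiableAt (by simp))
  unfold flowGram
  rw [h1]
  positivity

/-- The derivative of a solution of the Euler–Arnold equation along the flow. -/
theorem SolvesEulerArnold.hasDerivWithinAt_flow [MeasurableSpace M] (hJ : J.OrdConnected)
    (hn : J.Nontrivial) (hu : SmoothTimeDependentField J u) (hη : IsFlow J u η)
    (hh : SolvesEulerArnold g J u h) {t : ℝ} (ht : t ∈ J) (x : M) :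
    HasDerivWithinAt (fun s => h s (η s x)) (-(1 / 2) * h t (η t x) ^ 2
      - (1 / (2 * (volumeMeasure g).real univ)) * ∫ y, h t y ^ 2 ∂(volumeMeasure g)) J t := by
  set c := η t x with hc
  set V := (extChartAt (𝓡 n) c).target
  set z := extChartAt (𝓡 n) c c
  have hVo : IsOpen V := isOpen_extChartAt_target c
  have hzV : z ∈ V := mem_extChartAt_target c
  have hud := uniqueDiffOn_of_ordConnected hJ hn
  set H : ℝ × EuclideanSpace ℝ (Fin n) → ℝ := fun p => chartDiv g (u p.1) c p.2 with hH
  have hHeq : ∀ s ∈ J, ∀ y ∈ (extChartAt (𝓡 n) c).source,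
      h s y = H (s, extChartAt (𝓡 n) c y) := fun s hs y hy => by
    rw [hh.1 s hs y, divergence_eq_chartDiv g (u s)
      (fun c => hu.chartField_contDiffOn_slice hs c) c hy]
  have hHd : HasFDerivWithinAt H (fderivWithin ℝ H (J ×ˢ V) (t, z)) (J ×ˢ V) (t, z) :=
    ((chartDiv_contDiffOn g hud hu c).differentiableOn (by simp) (t, z)
      (mk_mem_prod ht hzV)).hasFDerivWithinAt
  set L := fderivWithin ℝ H (J ×ˢ V) (t, z)
  have hcsrc : c ∈ (extChartAt (𝓡 n) c).source := mem_extChartAt_source c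
  have hζ := hη.chart_hasDerivWithinAt c ht (x := x) hcsrc
  rw [← hc] at hζ
  change HasDerivWithinAt _ (chartField (u t) c z) J t at hζ
  have hev : ∀ᶠ s in nhdsWithin t J, η s x ∈ (extChartAt (𝓡 n) c).source :=
    (hη.continuousOn_curve x t ht).eventually
      ((isOpen_extChartAt_source c).mem_nhds hcsrc)
  -- the derivative along the curve, via the joint derivative in a chart
  have hcurve : HasDerivWithinAt (fun s => h s (η s x)) (L (1, chartField (u t) c z)) J t := by
    set J' := J ∩ {s | η s x ∈ (extChartAt (𝓡 n) c).source}
    have h1 : HasDerivWithinAt (fun s => (s, extChartAt (𝓡 n) c (η s x)))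
        ((1 : ℝ), chartField (u t) c z) J' t :=
      ((hasDerivWithinAt_id t J).prodMk hζ).mono inter_subset_left
    have h2 : HasFDerivWithinAt H L (J ×ˢ V) (t, extChartAt (𝓡 n) c (η t x)) := hHd
    have h3 := h2.comp_hasDerivWithinAt t h1
      (fun s hs => mk_mem_prod hs.1 ((extChartAt (𝓡 n) c).map_source hs.2))
    have h4 : HasDerivWithinAt (fun s => H (s, extChartAt (𝓡 n) c (η s x)))
        (L (1, chartField (u t) c z)) J t :=
      h3.mono_of_mem_nhdsWithin (Filter.inter_mem self_mem_nhdsWithin hev)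
    refine h4.congr_of_eventuallyEq ?_ (hHeq t ht _ hcsrc)
    filter_upwards [hev, self_mem_nhdsWithin] with s hs hsJ
    exact hHeq s hsJ _ hs
  have htime : HasDerivWithinAt (fun s => h s c) (L (1, 0)) J t := by
    have h1 : HasDerivWithinAt (fun s => (s, z)) ((1 : ℝ), (0 : EuclideanSpace ℝ (Fin n))) J t :=
      (hasDerivWithinAt_id t J).prodMk (hasDerivWithinAt_const t J z)
    have h2 := hHd.comp_hasDerivWithinAt t h1 (fun s hs => mk_mem_prod hs hzV)
    exact h2.congr (fun s hs => hHeq s hs c hcsrc) (hHeq t ht c hcsrc)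
  have hspace : HasMFDerivAt (𝓡 n) 𝓘(ℝ, ℝ) (h t) c
      ((L ∘L ContinuousLinearMap.inr ℝ ℝ _) ∘L (modelDeriv n (extChartAt (𝓡 n) c) c)) := by
    have h1 : HasFDerivWithinAt (fun w => (t, w))
        (ContinuousLinearMap.inr ℝ ℝ (EuclideanSpace ℝ (Fin n))) V z :=
      (hasFDerivAt_prodMk_right t z).hasFDerivWithinAt
    have h2 : HasFDerivAt (fun w => H (t, w)) (L ∘L ContinuousLinearMap.inr ℝ ℝ _) z :=
      (hHd.comp z h1 (fun w hw => mk_mem_prod ht hw)).hasFDerivAt (hVo.mem_nhds hzV)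
    have h3 : HasMFDerivAt (𝓡 n) (𝓡 n) (extChartAt (𝓡 n) c) c
        (modelDeriv n (extChartAt (𝓡 n) c) c) :=
      (mdifferentiableAt_extChartAt (mem_chart_source _ c)).hasMFDerivAt
    refine (h2.hasMFDerivAt.comp c h3).congr_of_eventuallyEq ?_
    filter_upwards [(isOpen_extChartAt_source (I := 𝓡 n) c).mem_nhds hcsrc] with y hy
    exact hHeq t ht y hy
  -- Derivatives within `J` are unique, so `h'` is the partial derivative `L (1, 0)`. The gradient
  -- term is `L (0, u)`, and the two add up to the derivative along the trajectory.
  obtain ⟨h', hh', hEq⟩ := hh.2 t ht c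
  have e1 : h' = L (1, 0) := (hud t ht).eq_deriv _ hh' htime
  have e2 : g.inner c (u t c) (gradient g (h t) c) = L (0, chartField (u t) c z) := by
    have h1 : mfderiv (𝓡 n) 𝓘(ℝ, ℝ) (h t) c (u t c) = L (0, chartField (u t) c z) := by
      rw [hspace.mfderiv]
      have h2 : modelDeriv n (extChartAt (𝓡 n) c) c (u t c) = chartField (u t) c z := by
        unfold chartField
        rw [show (extChartAt (𝓡 n) c).symm z = c from extChartAt_to_inv c]
      rw [← h2]
      rfl
    rw [← h1, g.symm]
    have h3 := LinearMap.BilinForm.apply_toDual_symm_apply (B := metricForm g c)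
      (hB := metricForm_nondegenerate g c)
      (mfderiv (𝓡 n) 𝓘(ℝ, ℝ) (h t) c).toLinearMap (u t c)
    exact h3
  refine hcurve.congr_deriv ?_
  have e3 : L (1, chartField (u t) c z) = L (1, 0) + L (0, chartField (u t) c z) := by
    rw [← map_add]; simp
  rw [e3, ← e1, ← e2]
  linarith

end Flow

/-! ### Bijectivity of the flow maps -/

section FlowBijective

set_option linter.unusedSectionVars false

variable {n : ℕ} {M : Type*} [TopologicalSpace M] [ChartedSpace (EuclideanSpace ℝ (Fin n)) M]
  [IsManifold (𝓡 n) ∞ M] {g : Metric n M} {J : Set ℝ}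
  {u : ℝ → (x : M) → TangentSpace (𝓡 n) x} {η : ℝ → M → M} {h : ℝ → M → ℝ}

/-- Two trajectories which meet at time `s` agree at all times close to `s`. -/
theorem IsFlow.eventually_eq_of_eq (hJ : J.OrdConnected)
    (hu : SmoothTimeDependentField J u) (hη : IsFlow J u η) {s : ℝ} (hs : s ∈ J) {x y : M}
    (hxy : η s x = η s y) : ∀ᶠ r in nhdsWithin s J, η r x = η r y := by
  set c := η s x with hc
  set V := (extChartAt (𝓡 n) c).target
  set z := extChartAt (𝓡 n) c c
  have hVo : IsOpen V := isOpen_extChartAt_target c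
  have hzV : z ∈ V := mem_extChartAt_target c
  obtain ⟨r, hr, hrV⟩ := Metric.isOpen_iff.1 hVo z hzV
  have hU : ContDiffWithinAt ℝ 1
      (fun p : ℝ × EuclideanSpace ℝ (Fin n) => chartField (u p.1) c p.2)
      (J ×ˢ Metric.ball z r) (s, z) :=
    ((chartField_contDiffOn hu c (s, z) (mk_mem_prod hs hzV)).mono
      (prod_mono_right hrV)).of_le ENat.LEInfty.out
  -- A `C¹` map on a convex set is Lipschitz near each of its points, also when `s` is an end point
  -- of `J`. A product neighbourhood `A × B` inside `T` then gives a Lipschitz constant in space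
  -- that is uniform in time.
  obtain ⟨K, T, hT, hK⟩ := hU.exists_lipschitzOnWith
    ((hJ.convex : Convex ℝ J).prod (convex_ball z r))
  rw [nhdsWithin_prod_eq, Metric.isOpen_ball.nhdsWithin_eq (Metric.mem_ball_self hr)] at hT
  obtain ⟨A, hA, B, hB, hAB⟩ := Filter.mem_prod_iff.1 hT
  have hsrc : ∀ w : M, η s w = c → ∀ᶠ q in nhdsWithin s J, q ∈ A ∧
      η q w ∈ (extChartAt (𝓡 n) c).source ∧ extChartAt (𝓡 n) c (η q w) ∈ B := by
    intro w hw
    have h1 := hη.continuousOn_curve w s hs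
    have h2 : ContinuousAt (extChartAt (𝓡 n) c) (η s w) := by
      rw [hw]; exact continuousAt_extChartAt c
    refine (Filter.Eventually.and hA (Filter.Eventually.and ?_ ?_))
    · exact h1.eventually ((isOpen_extChartAt_source c).mem_nhds
        (by change η s w ∈ _; rw [hw]; exact mem_extChartAt_source c))
    · exact (ContinuousAt.comp_continuousWithinAt (f := fun t => η t w) h2 h1).eventually (by
        change B ∈ nhds (extChartAt (𝓡 n) c (η s w)); rw [hw]; exact hB)
  obtain ⟨δ, hδ, hball⟩ := Metric.mem_nhdsWithin_iff.1 ((hsrc x rfl).and (hsrc y hxy.symm))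
  refine Metric.mem_nhdsWithin_iff.2 ⟨δ, hδ, ?_⟩
  rintro q ⟨hq, hqJ⟩
  have hlip : ∀ p ∈ Metric.ball s δ ∩ J, LipschitzOnWith K (chartField (u p) c) B := by
    intro p hp w hw w' hw'
    have := hK (hAB (mk_mem_prod (hball hp).1.1 hw)) (hAB (mk_mem_prod (hball hp).1.1 hw'))
    simpa [Prod.edist_eq] using this
  have hcont : ∀ w : M, (∀ p ∈ Metric.ball s δ ∩ J, η p w ∈ (extChartAt (𝓡 n) c).source) →
      ∀ p ∈ Metric.ball s δ ∩ J, HasDerivWithinAt (fun p => extChartAt (𝓡 n) c (η p w))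
        (chartField (u p) c (extChartAt (𝓡 n) c (η p w))) J p := fun w hw p hp =>
    hη.chart_hasDerivWithinAt c hp.2 (hw p hp)
  have hx := hcont x fun p hp => (hball hp).1.2.1
  have hy := hcont y fun p hp => (hball hp).2.2.1
  have h0 : extChartAt (𝓡 n) c (η s x) = extChartAt (𝓡 n) c (η s y) := by rw [← hxy]
  have hfin : extChartAt (𝓡 n) c (η q x) = extChartAt (𝓡 n) c (η q y) := by
    have hconv : (Metric.ball s δ ∩ J).OrdConnected :=
      ((convex_ball s δ).ordConnected).inter hJ
    have hsB : s ∈ Metric.ball s δ ∩ J := ⟨Metric.mem_ball_self hδ, hs⟩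
    rcases le_total s q with hsq | hsq
    · have hsub : Icc s q ⊆ Metric.ball s δ ∩ J := hconv.out hsB ⟨hq, hqJ⟩
      have hsubJ : Icc s q ⊆ J := hsub.trans inter_subset_right
      refine ODE_solution_unique_of_mem_Icc_right (v := fun p => chartField (u p) c)
        (s := fun _ => B) (K := K) (fun p hp => hlip p (hsub (Ico_subset_Icc_self hp)))
        (fun p hp => ((hx p (hsub hp)).continuousWithinAt).mono hsubJ)
        (fun p hp => hasDerivWithinAt_Ici_of_subset (hx p (hsub (Ico_subset_Icc_self hp))) hp.2
          ((Icc_subset_Icc_left hp.1).trans hsubJ))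
        (fun p hp => (hball (hsub (Ico_subset_Icc_self hp))).1.2.2)
        (fun p hp => ((hy p (hsub hp)).continuousWithinAt).mono hsubJ)
        (fun p hp => hasDerivWithinAt_Ici_of_subset (hy p (hsub (Ico_subset_Icc_self hp))) hp.2
          ((Icc_subset_Icc_left hp.1).trans hsubJ))
        (fun p hp => (hball (hsub (Ico_subset_Icc_self hp))).2.2.2) h0 ⟨hsq, le_rfl⟩
    · have hsub : Icc q s ⊆ Metric.ball s δ ∩ J := hconv.out ⟨hq, hqJ⟩ hsB
      have hsubJ : Icc q s ⊆ J := hsub.trans inter_subset_right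
      refine ODE_solution_unique_of_mem_Icc_left (v := fun p => chartField (u p) c)
        (s := fun _ => B) (K := K) (fun p hp => hlip p (hsub (Ioc_subset_Icc_self hp)))
        (fun p hp => ((hx p (hsub hp)).continuousWithinAt).mono hsubJ)
        (fun p hp => hasDerivWithinAt_Iic_of_subset (hx p (hsub (Ioc_subset_Icc_self hp))) hp.1
          ((Icc_subset_Icc_right hp.2).trans hsubJ))
        (fun p hp => (hball (hsub (Ioc_subset_Icc_self hp))).1.2.2)
        (fun p hp => ((hy p (hsub hp)).continuousWithinAt).mono hsubJ)
        (fun p hp => hasDerivWithinAt_Iic_of_subset (hy p (hsub (Ioc_subset_Icc_self hp))) hp.1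
          ((Icc_subset_Icc_right hp.2).trans hsubJ))
        (fun p hp => (hball (hsub (Ioc_subset_Icc_self hp))).2.2.2) h0 ⟨le_rfl, hsq⟩
  exact (extChartAt (𝓡 n) c).injOn (hball ⟨hq, hqJ⟩).1.2.1 (hball ⟨hq, hqJ⟩).2.2.1 hfin

/-- The times at which two trajectories coincide form a set that is open in `J` by local uniqueness
and closed because `M` is Hausdorff. If it contains `t`, it therefore contains `0`, where the
trajectories start at `x` and `y`. -/
theorem IsFlow.injective [T2Space M] (hJ : J.OrdConnected) (h0J : (0 : ℝ) ∈ J)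
    (hu : SmoothTimeDependentField J u) (hη : IsFlow J u η) {t : ℝ} (ht : t ∈ J) :
    Function.Injective (η t) := by
  intro x y hxy
  have : PreconnectedSpace J := Subtype.preconnectedSpace hJ.isPreconnected
  have hclopen : IsClopen {s : J | η s x = η s y} := by
    constructor
    · exact isClosed_eq (hη.continuousOn_curve x).domRestrict (hη.continuousOn_curve y).domRestrict
    · rw [isOpen_iff_mem_nhds]
      rintro ⟨s, hs⟩ hsxy
      have h1 := hη.eventually_eq_of_eq hJ hu hs hsxy
      rw [nhds_subtype_eq_comap_nhdsWithin]
      exact ⟨_, h1, fun _ h => h⟩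
  have huniv := hclopen.eq_univ ⟨⟨t, ht⟩, hxy⟩
  have h2 : (⟨0, h0J⟩ : J) ∈ {s : J | η s x = η s y} := by rw [huniv]; trivial
  have h3 : η 0 x = η 0 y := h2
  rwa [hη.initial, hη.initial] at h3

/-- The inverse function theorem in charts: a nonzero Gram determinant makes the differential of the
coordinate expression invertible, so neighbourhoods are mapped to neighbourhoods. -/
theorem isOpenMap_of_gramDet_ne_zero (g : Metric n M) {φ : M → M}
    (hφ : ContMDiff (𝓡 n) (𝓡 n) ∞ φ) (hdet : ∀ x, gramDet g (φ x)
      (fun i => modelDeriv n φ x (EuclideanSpace.single i (1 : ℝ))) ≠ 0) : IsOpenMap φ := by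
  rw [isOpenMap_iff_nhds_le]
  intro x
  set c' := φ x with hc'
  set z := extChartAt (𝓡 n) x x with hz
  set f := extChartAt (𝓡 n) c' ∘ φ ∘ (extChartAt (𝓡 n) x).symm with hf
  have hxz : (extChartAt (𝓡 n) x).symm z = x := extChartAt_to_inv x
  have hVz := (isOpen_extChartAt_target (I := 𝓡 n) x).mem_nhds (mem_extChartAt_target x)
  have hsymm : ContMDiffAt (𝓡 n) (𝓡 n) ∞ (extChartAt (𝓡 n) x).symm z :=
    (contMDiffOn_extChartAt_symm x).contMDiffAt hVz
  have hfc : ContDiffAt ℝ ∞ f z := by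
    rw [← contMDiffAt_iff_contDiffAt]
    have h1 : ContMDiffAt (𝓡 n) (𝓡 n) ∞ (φ ∘ (extChartAt (𝓡 n) x).symm) z :=
      hφ.contMDiffAt.comp z hsymm
    have h2 : ContMDiffAt (𝓡 n) (𝓡 n) ∞ (extChartAt (𝓡 n) c')
        ((φ ∘ (extChartAt (𝓡 n) x).symm) z) := by
      simp only [Function.comp, hxz]
      exact contMDiffAt_extChartAt
    exact h2.comp z h1
  have hdet' : (fderiv ℝ f z).det ≠ 0 := by
    intro h0
    apply hdet x
    rw [gramDet_modelDeriv_eq_chart g x c' φ (mem_extChartAt_source x)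
      (mem_extChartAt_source c') (hφ.mdifferentiableAt (by simp))]
    change (_ * (fderiv ℝ f z).det) ^ 2 * _ = 0
    rw [h0]; ring
  have hstrict : HasStrictFDerivAt f (((fderiv ℝ f z).toContinuousLinearEquivOfDetNeZero hdet' :
      EuclideanSpace ℝ (Fin n) ≃L[ℝ] EuclideanSpace ℝ (Fin n)) :
      EuclideanSpace ℝ (Fin n) →L[ℝ] EuclideanSpace ℝ (Fin n)) z := by
    rw [ContinuousLinearMap.coe_toContinuousLinearEquivOfDetNeZero]
    exact hfc.hasStrictFDerivAt (by simp)
  have hmap := hstrict.map_nhds_eq_of_equiv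
  have hs1 : Filter.map (extChartAt (𝓡 n) x).symm (nhds z) = nhds x := by
    have := map_extChartAt_symm_nhdsWithin_range (I := 𝓡 n) x
    rwa [modelWithCornersSelf_coe, range_id, nhdsWithin_univ] at this
  have hs2 : Filter.map (extChartAt (𝓡 n) c').symm (nhds (f z)) = nhds c' := by
    have := map_extChartAt_symm_nhdsWithin_range (I := 𝓡 n) c'
    have h3 : f z = extChartAt (𝓡 n) c' c' := by
      simp only [hf, Function.comp, hxz, ← hc']
    rw [h3]
    rwa [modelWithCornersSelf_coe, range_id, nhdsWithin_univ] at this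
  have hev : (extChartAt (𝓡 n) c').symm ∘ f =ᶠ[nhds z] φ ∘ (extChartAt (𝓡 n) x).symm := by
    have h1 : ContinuousAt (φ ∘ (extChartAt (𝓡 n) x).symm) z :=
      hφ.continuous.continuousAt.comp hsymm.continuousAt
    have h2 := h1.eventually ((isOpen_extChartAt_source (I := 𝓡 n) c').mem_nhds
      (by simp only [Function.comp, hxz]; exact mem_extChartAt_source c'))
    filter_upwards [h2] with w hw
    exact (extChartAt (𝓡 n) c').left_inv hw
  rw [← hs2, ← hmap, Filter.map_map, Filter.map_congr hev, ← Filter.map_map, hs1]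

/-- The range of `η t` is open, and closed because it is compact. The trajectory of `y` is connected
and meets the range at time `t`, so it stays inside; at time `0` it is at `y`. Thus `M` need not be
connected. -/
theorem IsFlow.surjective [T2Space M] [CompactSpace M] (hJ : J.OrdConnected) (h0J : (0 : ℝ) ∈ J)
    (hη : IsFlow J u η) {t : ℝ} (ht : t ∈ J) (hopen : IsOpenMap (η t)) :
    Function.Surjective (η t) := by
  intro y
  have hcont := (hη.contMDiff ht).continuous
  have hclopen : IsClopen (range (η t)) :=
    ⟨(isCompact_range hcont).isClosed, hopen.isOpen_range⟩
  have hpre : IsPreconnected ((fun s => η s y) '' J) :=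
    hJ.isPreconnected.image _ (hη.continuousOn_curve y)
  have hsub := hpre.subset_isClopen hclopen
    ⟨η t y, mem_image_of_mem _ ht, mem_range_self y⟩
  exact hsub ⟨0, h0J, hη.initial y⟩

end FlowBijective

/-! ### The Riemannian measure and the change of variables -/

section Volume

set_option linter.unusedSectionVars false

variable {n : ℕ} {M : Type*} [TopologicalSpace M] [ChartedSpace (EuclideanSpace ℝ (Fin n)) M]
  [IsManifold (𝓡 n) ∞ M] [MeasurableSpace M] [BorelSpace M]

theorem measurableSet_chart_preimage (c : M) {A : Set M} (hA : MeasurableSet A) :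
    MeasurableSet ((extChartAt (𝓡 n) c).target ∩ (extChartAt (𝓡 n) c).symm ⁻¹' A) := by
  have h1 : Continuous ((extChartAt (𝓡 n) c).target.domRestrict (extChartAt (𝓡 n) c).symm) :=
    (continuousOn_extChartAt_symm c).domRestrict
  have h2 := (isOpen_extChartAt_target (I := 𝓡 n) c).measurableSet.subtype_image
    (h1.measurable hA)
  convert h2
  ext z
  simp [and_comm]

theorem setLIntegral_chartVolume (g : Metric n M) (c : M) {A : Set M} (hA : MeasurableSet A)
    {F : M → ENNReal} (hF : Measurable F) :
    ∫⁻ x in A, F x ∂(chartVolume g c) =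
      ∫⁻ z in (extChartAt (𝓡 n) c).target ∩ (extChartAt (𝓡 n) c).symm ⁻¹' A,
        ENNReal.ofReal (sqrtDetMetric g c z) * F ((extChartAt (𝓡 n) c).symm z) := by
  have hV : MeasurableSet (extChartAt (𝓡 n) c).target :=
    (isOpen_extChartAt_target (I := 𝓡 n) c).measurableSet
  have hB := measurableSet_chart_preimage (n := n) c hA
  have hsymm : AEMeasurable (extChartAt (𝓡 n) c).symm
      (volume.restrict (extChartAt (𝓡 n) c).target) :=
    (continuousOn_extChartAt_symm c).aemeasurable hV
  have hS : AEMeasurable (fun z => ENNReal.ofReal (sqrtDetMetric g c z))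
      (volume.restrict (extChartAt (𝓡 n) c).target) :=
    ((sqrtDetMetric_contDiffOn g c).continuousOn.aemeasurable hV).ennreal_ofReal
  rw [← lintegral_indicator hA, chartVolume, lintegral_map' (hF.indicator hA).aemeasurable
    (hsymm.mono_ac (withDensity_absolutelyContinuous _ _)),
    lintegral_withDensity_eq_lintegral_mul_non_measurable₀ _ hS
      (Filter.Eventually.of_forall fun _ => ENNReal.ofReal_lt_top), ← lintegral_indicator hB,
    ← lintegral_indicator hV]
  refine lintegral_congr fun z => ?_
  by_cases hz : z ∈ (extChartAt (𝓡 n) c).target <;>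
    by_cases hzA : (extChartAt (𝓡 n) c).symm z ∈ A <;>
    simp only [indicator, Pi.mul_apply, mem_inter_iff, mem_preimage, hz, hzA, true_and, false_and,
      and_false, if_true, if_false, mul_zero]

theorem chartVolume_apply (g : Metric n M) (c : M) {A : Set M} (hA : MeasurableSet A) :
    chartVolume g c A =
      ∫⁻ z in (extChartAt (𝓡 n) c).target ∩ (extChartAt (𝓡 n) c).symm ⁻¹' A,
        ENNReal.ofReal (sqrtDetMetric g c z) := by
  have h := setLIntegral_chartVolume g c hA (F := fun _ => 1) measurable_const
  simpa using h

theorem jacobian_nonneg (g : Metric n M) (φ : M → M) (x : M) : 0 ≤ jacobian g φ x :=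
  div_nonneg (Real.sqrt_nonneg _) (Real.sqrt_nonneg _)

/-- Change of variables for a map between two chart domains. -/
theorem chartVolume_image (g : Metric n M) (c c' : M) {φ : M → M} {A : Set M}
    (hA : MeasurableSet A) (hAc : A ⊆ (extChartAt (𝓡 n) c).source)
    (hφ : ∀ x ∈ A, MDifferentiableAt (𝓡 n) (𝓡 n) φ x) (hinj : InjOn φ A)
    (hφA : MeasurableSet (φ '' A)) (hAc' : φ '' A ⊆ (extChartAt (𝓡 n) c').source)
    (hjac : Measurable (jacobian g φ)) :
    chartVolume g c' (φ '' A) = ∫⁻ x in A, ENNReal.ofReal (jacobian g φ x) ∂(chartVolume g c) := by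
  rw [chartVolume_apply g c' hφA, setLIntegral_chartVolume g c hA hjac.ennreal_ofReal]
  set B := (extChartAt (𝓡 n) c).target ∩ (extChartAt (𝓡 n) c).symm ⁻¹' A with hB
  set f := extChartAt (𝓡 n) c' ∘ φ ∘ (extChartAt (𝓡 n) c).symm with hf
  have himage : (extChartAt (𝓡 n) c').target ∩ (extChartAt (𝓡 n) c').symm ⁻¹' (φ '' A) =
      f '' B := by
    ext w
    constructor
    · rintro ⟨hw, x, hx, hxw⟩
      refine ⟨extChartAt (𝓡 n) c x, ⟨(extChartAt (𝓡 n) c).map_source (hAc hx), ?_⟩, ?_⟩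
      · rw [mem_preimage, (extChartAt (𝓡 n) c).left_inv (hAc hx)]; exact hx
      · simp only [hf, Function.comp, (extChartAt (𝓡 n) c).left_inv (hAc hx)]
        rw [hxw, (extChartAt (𝓡 n) c').right_inv hw]
    · rintro ⟨z, ⟨_, hzA⟩, rfl⟩
      have h1 := hAc' (mem_image_of_mem φ hzA)
      refine ⟨(extChartAt (𝓡 n) c').map_source h1, ?_⟩
      simp only [hf, Function.comp, mem_preimage, (extChartAt (𝓡 n) c').left_inv h1]
      exact mem_image_of_mem φ hzA
  have hd : ∀ z ∈ B, HasFDerivAt f (fderiv ℝ f z) z := by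
    rintro z ⟨hz, hzA⟩
    have h1 := hasFDerivAt_chart_comp c c' φ (hAc hzA) (hAc' (mem_image_of_mem φ hzA)) (hφ _ hzA)
    rw [(extChartAt (𝓡 n) c).right_inv hz] at h1
    exact h1.differentiableAt.hasFDerivAt
  have hfinj : InjOn f B := by
    rintro z ⟨hz, hzA⟩ w ⟨hw, hwA⟩ hzw
    have h1 := (extChartAt (𝓡 n) c').injOn (hAc' (mem_image_of_mem φ hzA))
      (hAc' (mem_image_of_mem φ hwA)) hzw
    exact (extChartAt (𝓡 n) c).symm.injOn hz hw (hinj hzA hwA h1)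
  have hBm : MeasurableSet B := measurableSet_chart_preimage c hA
  rw [himage, lintegral_image_eq_lintegral_abs_det_fderiv_mul volume hBm
    (fun z hz => (hd z hz).hasFDerivWithinAt) hfinj]
  refine setLIntegral_congr_fun hBm ?_
  rintro z ⟨hz, hzA⟩
  have h1 := jacobian_eq_chart g c c' φ (hAc hzA) (hAc' (mem_image_of_mem φ hzA)) (hφ _ hzA)
  rw [(extChartAt (𝓡 n) c).right_inv hz] at h1
  have hpos := sqrtDetMetric_pos g c hz
  simp only
  rw [← ENNReal.ofReal_mul (abs_nonneg _), ← ENNReal.ofReal_mul hpos.le, h1]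
  congr 1
  rw [mul_div_cancel₀ _ hpos.ne', mul_comm]
  rfl

theorem chartVolume_eq_of_subset (g : Metric n M) (c c' : M) {A : Set M} (hA : MeasurableSet A)
    (hAc : A ⊆ (extChartAt (𝓡 n) c).source) (hAc' : A ⊆ (extChartAt (𝓡 n) c').source) :
    chartVolume g c' A = chartVolume g c A := by
  have hj : jacobian g (id : M → M) = fun _ => 1 := funext fun x => jacobian_id g x
  have h := chartVolume_image g c c' (φ := id) hA hAc (fun _ _ => mdifferentiableAt_id)
    (injOn_id _) (by rwa [image_id]) (by rwa [image_id]) (by rw [hj]; exact measurable_const)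
  rw [image_id, hj] at h
  simpa using h

theorem chartVolume_inter_source (g : Metric n M) (c : M) {A : Set M} (hA : MeasurableSet A) :
    chartVolume g c (A ∩ (extChartAt (𝓡 n) c).source) = chartVolume g c A := by
  rw [chartVolume_apply g c hA, chartVolume_apply g c
    (hA.inter (isOpen_extChartAt_source (I := 𝓡 n) c).measurableSet)]
  congr 2
  ext z
  simp only [mem_inter_iff, mem_preimage]
  exact ⟨fun h => ⟨h.1, h.2.1⟩, fun h => ⟨h.1, h.2, (extChartAt (𝓡 n) c).map_target h.1⟩⟩

/-- The Riemannian volume of a subset of a chart domain is computed in that chart. -/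
theorem volumeMeasure_eq_chartVolume (g : Metric n M) (c : M) {A : Set M} (hA : MeasurableSet A)
    (hAc : A ⊆ (extChartAt (𝓡 n) c).source) : volumeMeasure g A = chartVolume g c A := by
  refine le_antisymm ?_ (le_iSup (chartVolume g) c A)
  have hsrc : MeasurableSet (extChartAt (𝓡 n) c).source :=
    (isOpen_extChartAt_source (I := 𝓡 n) c).measurableSet
  -- It suffices to bound each chart measure. Inside the domain of the chart at `c` it agrees with
  -- `chartVolume g c` on the overlap and is zero elsewhere; outside, it is at most the supremum.
  -- The second summand vanishes on subsets of that domain.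
  have hle : volumeMeasure g ≤ (chartVolume g c).restrict (extChartAt (𝓡 n) c).source +
      (volumeMeasure g).restrict (extChartAt (𝓡 n) c).sourceᶜ := by
    refine iSup_le fun c' => Measure.le_iff.2 fun B hB => ?_
    rw [Measure.add_apply, Measure.restrict_apply hB, Measure.restrict_apply hB,
      ← measure_inter_add_sdiff B hsrc]
    have hsrc' : MeasurableSet (extChartAt (𝓡 n) c').source :=
      (isOpen_extChartAt_source (I := 𝓡 n) c').measurableSet
    refine add_le_add ?_ (le_iSup (chartVolume g) c' _)
    rw [← chartVolume_inter_source g c' (hB.inter hsrc),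
      chartVolume_eq_of_subset g c c' ((hB.inter hsrc).inter hsrc')
        (inter_subset_left.trans inter_subset_right) inter_subset_right]
    exact measure_mono inter_subset_left
  refine (hle A).trans ?_
  rw [Measure.add_apply, Measure.restrict_apply hA, Measure.restrict_apply hA,
    inter_eq_self_of_subset_left hAc, ← sdiff_eq, sdiff_eq_empty.2 hAc, measure_empty, add_zero]

theorem volumeMeasure_restrict (g : Metric n M) (c : M) {A : Set M} (hA : MeasurableSet A)
    (hAc : A ⊆ (extChartAt (𝓡 n) c).source) :
    (volumeMeasure g).restrict A = (chartVolume g c).restrict A := by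
  ext B hB
  rw [Measure.restrict_apply hB, Measure.restrict_apply hB,
    volumeMeasure_eq_chartVolume g c (hB.inter hA) (inter_subset_right.trans hAc)]

/-- Needed for `μ(M) > 0` when `M` is nonempty, and for the fact that a continuous function with
zero mean square vanishes everywhere. -/
instance volumeMeasure_isOpenPosMeasure (g : Metric n M) : (volumeMeasure g).IsOpenPosMeasure := by
  refine ⟨fun O hO ⟨x, hx⟩ h0 => ?_⟩
  set A := O ∩ (extChartAt (𝓡 n) x).source
  have hAo : IsOpen A := hO.inter (isOpen_extChartAt_source x)
  have h1 : volumeMeasure g A = 0 := measure_mono_null inter_subset_left h0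
  rw [volumeMeasure_eq_chartVolume g x hAo.measurableSet inter_subset_right,
    chartVolume_apply g x hAo.measurableSet] at h1
  set B := (extChartAt (𝓡 n) x).target ∩ (extChartAt (𝓡 n) x).symm ⁻¹' A
  have hBo : IsOpen B :=
    (continuousOn_extChartAt_symm x).isOpen_inter_preimage (isOpen_extChartAt_target x) hAo
  have hBn : B.Nonempty := by
    refine ⟨extChartAt (𝓡 n) x x, mem_extChartAt_target x, ?_⟩
    rw [mem_preimage, extChartAt_to_inv]
    exact ⟨hx, mem_extChartAt_source x⟩
  have hS : AEMeasurable (fun z => ENNReal.ofReal (sqrtDetMetric g x z)) (volume.restrict B) :=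
    (((sqrtDetMetric_contDiffOn g x).continuousOn.mono inter_subset_left).aemeasurable
      hBo.measurableSet).ennreal_ofReal
  rw [lintegral_eq_zero_iff' hS, Filter.EventuallyEq, ae_restrict_iff' hBo.measurableSet] at h1
  refine hBo.measure_ne_zero volume hBn (measure_mono_null (fun z hz => ?_) h1)
  simp only [mem_compl_iff, mem_ofPred_eq, Classical.not_imp]
  exact ⟨hz, by simpa using sqrtDetMetric_pos g x hz.1⟩

/-- On a compact manifold this makes `μ(M)` finite and continuous functions integrable. -/
instance volumeMeasure_isLocallyFiniteMeasure (g : Metric n M) :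
    IsLocallyFiniteMeasure (volumeMeasure g) := by
  refine ⟨fun x => ?_⟩
  have hS : ContinuousAt (sqrtDetMetric g x) (extChartAt (𝓡 n) x x) :=
    (sqrtDetMetric_contDiffOn g x).continuousOn.continuousAt
      ((isOpen_extChartAt_target x).mem_nhds (mem_extChartAt_target x))
  set z := extChartAt (𝓡 n) x x
  have hev : ∀ᶠ w in nhds z, sqrtDetMetric g x w < sqrtDetMetric g x z + 1 :=
    hS.eventually (gt_mem_nhds (lt_add_one _))
  obtain ⟨r, hr, hball⟩ := Metric.eventually_nhds_iff_ball.1 hev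
  set A := (extChartAt (𝓡 n) x).source ∩ extChartAt (𝓡 n) x ⁻¹' Metric.ball z r
  have hAo : IsOpen A := (continuousOn_extChartAt x).isOpen_inter_preimage
    (isOpen_extChartAt_source x) Metric.isOpen_ball
  refine ⟨A, hAo.mem_nhds ⟨mem_extChartAt_source x, Metric.mem_ball_self hr⟩, ?_⟩
  rw [volumeMeasure_eq_chartVolume g x hAo.measurableSet inter_subset_left,
    chartVolume_apply g x hAo.measurableSet]
  have hsub : (extChartAt (𝓡 n) x).target ∩ (extChartAt (𝓡 n) x).symm ⁻¹' A ⊆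
      Metric.ball z r := by
    rintro w ⟨hw, hw2⟩
    have := hw2.2
    rwa [mem_preimage, (extChartAt (𝓡 n) x).right_inv hw] at this
  calc _ ≤ ∫⁻ w in Metric.ball z r, ENNReal.ofReal (sqrtDetMetric g x w) :=
        lintegral_mono_set hsub
    _ ≤ ∫⁻ _ in Metric.ball z r, ENNReal.ofReal (sqrtDetMetric g x z + 1) :=
        setLIntegral_mono measurable_const
          fun w hw => ENNReal.ofReal_le_ofReal (hball w hw).le
    _ < ⊤ := by
        rw [setLIntegral_const]
        exact ENNReal.mul_lt_top ENNReal.ofReal_lt_top Metric.isBounded_ball.measure_lt_top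

/-- Change of variables for a diffeomorphism of a compact manifold. -/
theorem lintegral_jacobian [T2Space M] [CompactSpace M] (g : Metric n M) {φ : M → M}
    (hφ : ContMDiff (𝓡 n) (𝓡 n) ∞ φ) (hbij : Function.Bijective φ)
    (hjac : Measurable (jacobian g φ)) :
    ∫⁻ x, ENNReal.ofReal (jacobian g φ x) ∂(volumeMeasure g) = volumeMeasure g univ := by
  have hcl : Topology.IsClosedEmbedding φ := hφ.continuous.isClosedEmbedding hbij.1
  have hemb : MeasurableEmbedding φ := hcl.measurableEmbedding
  set W : M → Set M := fun x =>
    (extChartAt (𝓡 n) x).source ∩ φ ⁻¹' (extChartAt (𝓡 n) (φ x)).source with hW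
  have hWo : ∀ x, IsOpen (W x) := fun x => (isOpen_extChartAt_source x).inter
    ((isOpen_extChartAt_source (φ x)).preimage hφ.continuous)
  obtain ⟨s, hs⟩ := isCompact_univ.elim_finite_subcover W hWo
    (fun x _ => mem_iUnion.2 ⟨x, mem_extChartAt_source x, mem_extChartAt_source (φ x)⟩)
  -- The identity of measures `J μ = φ^* μ` is local, so it is checked on the finitely many sets `W
  -- x`, each of which lies in one chart domain and is mapped into one chart domain.
  have hkey : (volumeMeasure g).withDensity (fun x => ENNReal.ofReal (jacobian g φ x)) =
      (volumeMeasure g).comap φ := by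
    rw [← Measure.restrict_univ (μ := (volumeMeasure g).withDensity _),
      ← Measure.restrict_univ (μ := (volumeMeasure g).comap φ), ← univ_subset_iff.1 hs]
    refine (Measure.restrict_biUnion_congr s.countable_toSet).2 fun x _ => ?_
    ext A hA
    have hAW : MeasurableSet (A ∩ W x) := hA.inter (hWo x).measurableSet
    rw [Measure.restrict_apply hA, Measure.restrict_apply hA, withDensity_apply _ hAW,
      hemb.comap_apply, volumeMeasure_restrict g x hAW (inter_subset_right.trans inter_subset_left)]
    have himg : φ '' (A ∩ W x) ⊆ (extChartAt (𝓡 n) (φ x)).source := by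
      rintro _ ⟨y, hy, rfl⟩; exact hy.2.2
    rw [volumeMeasure_eq_chartVolume g (φ x) (hemb.measurableSet_image.2 hAW) himg]
    exact (chartVolume_image g x (φ x) hAW (inter_subset_right.trans inter_subset_left)
      (fun y _ => hφ.mdifferentiableAt (by simp)) hbij.1.injOn (hemb.measurableSet_image.2 hAW)
      himg hjac).symm
  have h := congrArg (fun ν : Measure M => ν univ) hkey
  simp only [withDensity_apply _ MeasurableSet.univ, Measure.restrict_univ] at h
  rw [h, hemb.comap_apply, image_univ, hbij.2.range_eq]

theorem integral_jacobian [T2Space M] [CompactSpace M] (g : Metric n M) {φ : M → M}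
    (hφ : ContMDiff (𝓡 n) (𝓡 n) ∞ φ) (hbij : Function.Bijective φ)
    (hjac : Measurable (jacobian g φ)) :
    ∫ x, jacobian g φ x ∂(volumeMeasure g) = (volumeMeasure g).real univ := by
  rw [integral_eq_lintegral_of_nonneg_ae (Filter.Eventually.of_forall (jacobian_nonneg g φ))
    hjac.aestronglyMeasurable, lintegral_jacobian g hφ hbij hjac]
  rfl

end Volume

/-! ### The scalar equations along a trajectory -/

section ScalarEquations

theorem eq_of_hasDerivWithinAt_zero {J : Set ℝ} (hJ : J.OrdConnected) {f : ℝ → ℝ}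
    (hf : ∀ t ∈ J, HasDerivWithinAt f 0 J t) {s t : ℝ} (hs : s ∈ J) (ht : t ∈ J) : f t = f s := by
  have h := (hJ.convex : Convex ℝ J).norm_image_sub_le_of_norm_hasDerivWithin_le (C := 0) hf
    (fun _ _ => by simp) hs ht
  rw [zero_mul] at h
  exact sub_eq_zero.1 (norm_le_zero_iff.1 h)

/-- The root linearises the Riccati equation: if also `y' = -y²/2 - C/2`, then the derivative
`y√ρ/2` found here has derivative `-(C/4)√ρ`. -/
theorem hasDerivWithinAt_sqrt_density {J : Set ℝ} {ρ y : ℝ → ℝ} {t : ℝ} (hpos : 0 < ρ t)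
    (hρ : HasDerivWithinAt ρ (y t * ρ t) J t) :
    HasDerivWithinAt (fun s => Real.sqrt (ρ s)) (y t / 2 * Real.sqrt (ρ t)) J t := by
  refine (hρ.sqrt hpos.ne').congr_deriv ?_
  have h := Real.sqrt_pos.2 hpos
  have h2 := Real.mul_self_sqrt hpos.le
  rw [div_eq_iff (by positivity)]
  linear_combination -(y t) * h2

/-- The square roots of two densities solve the same linear equation of second order; the
derivative of their quotient is given by their Wronskian, which is constant. -/
theorem hasDerivWithinAt_sqrt_quotient {J : Set ℝ} (hJ : J.OrdConnected) (h0 : (0 : ℝ) ∈ J)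
    {C ρ₁ ρ₂ y₁ y₂ : ℝ → ℝ} (hp₁ : ∀ t ∈ J, 0 < ρ₁ t) (hp₂ : ∀ t ∈ J, 0 < ρ₂ t)
    (hρ₁ : ∀ t ∈ J, HasDerivWithinAt ρ₁ (y₁ t * ρ₁ t) J t)
    (hρ₂ : ∀ t ∈ J, HasDerivWithinAt ρ₂ (y₂ t * ρ₂ t) J t)
    (hy₁ : ∀ t ∈ J, HasDerivWithinAt y₁ (-(1 / 2) * y₁ t ^ 2 - C t / 2) J t)
    (hy₂ : ∀ t ∈ J, HasDerivWithinAt y₂ (-(1 / 2) * y₂ t ^ 2 - C t / 2) J t)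
    (hi₁ : ρ₁ 0 = 1) (hi₂ : ρ₂ 0 = 1) {t : ℝ} (ht : t ∈ J) :
    HasDerivWithinAt (fun s => Real.sqrt (ρ₁ s) / Real.sqrt (ρ₂ s))
      ((y₁ 0 - y₂ 0) / 2 * (1 / ρ₂ t)) J t := by
  have hW : ∀ s ∈ J, HasDerivWithinAt
      (fun s => (y₁ s - y₂ s) / 2 * (Real.sqrt (ρ₁ s) * Real.sqrt (ρ₂ s))) 0 J s := by
    intro s hs
    refine ((((hy₁ s hs).sub (hy₂ s hs)).div_const 2).mul
      ((hasDerivWithinAt_sqrt_density (hp₁ s hs) (hρ₁ s hs)).mul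
        (hasDerivWithinAt_sqrt_density (hp₂ s hs) (hρ₂ s hs)))).congr_deriv ?_
    simp only [Pi.sub_apply, Pi.mul_apply]
    ring
  have hc := eq_of_hasDerivWithinAt_zero hJ hW h0 ht
  simp only [hi₁, hi₂, Real.sqrt_one, mul_one] at hc
  have hs₂ := Real.sqrt_pos.2 (hp₂ t ht)
  refine ((hasDerivWithinAt_sqrt_density (hp₁ t ht) (hρ₁ t ht)).div
    (hasDerivWithinAt_sqrt_density (hp₂ t ht) (hρ₂ t ht)) hs₂.ne').congr_deriv ?_
  rw [← hc]
  have hsq := Real.sq_sqrt (hp₂ t ht).le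
  rw [hsq]
  ring

/-- If the densities `ρ₀ (1 + w T)²` have constant total mass `m`, the speed is constant. -/
theorem speed_eq_of_mass_eq {J : Set ℝ} (hJ : UniqueDiffOn ℝ J) {C ρ y T : ℝ → ℝ} {m A B : ℝ}
    (hm : 0 < m) (hp : ∀ t ∈ J, 0 < ρ t)
    (hρ : ∀ t ∈ J, HasDerivWithinAt ρ (y t * ρ t) J t)
    (hy : ∀ t ∈ J, HasDerivWithinAt y (-(1 / 2) * y t ^ 2 - C t / 2) J t)
    (hT : ∀ t ∈ J, HasDerivWithinAt T (1 / ρ t) J t)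
    (hmass : ∀ t ∈ J, ρ t * (m + 2 * A * T t + B * T t ^ 2) = m) {t : ℝ} (ht : t ∈ J) :
    C t = 4 * (B * m - A ^ 2) / m ^ 2 := by
  -- First derivative of the mass identity: with `ρ T' = 1` it reads `y m + 2A + 2BT = 0`.
  have hyT : ∀ s ∈ J, y s = -(2 * A + 2 * B * T s) / m := by
    intro s hs
    have h1 : HasDerivWithinAt (fun s => ρ s * (m + 2 * A * T s + B * T s ^ 2)) _ J s :=
      (hρ s hs).mul ((((hT s hs).const_mul (2 * A)).const_add m).add
        (((hT s hs).pow 2).const_mul B))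
    have h2 := (hJ s hs).eq_deriv _ h1
      ((hasDerivWithinAt_const s J m).congr hmass (hmass s hs))
    have hps := (hp s hs).ne'
    have hms := hmass s hs
    rw [eq_div_iff hm.ne']
    have h3 : ρ s * (1 / ρ s) = 1 := mul_one_div_cancel hps
    push_cast at h2
    linear_combination h2 - y s * hms - (2 * A + 2 * B * T s) * h3
  have h1 : HasDerivWithinAt (fun s => -(2 * A + 2 * B * T s) / m) _ J t :=
    ((((hT t ht).const_mul (2 * B)).const_add (2 * A)).neg).div_const m
  -- Second derivative, compared with the Riccati equation. Replacing `1/ρ` by means of the mass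
  -- identity makes every term with `T` cancel.
  have h2 := (hJ t ht).eq_deriv _ (hy t ht) (h1.congr hyT (hyT t ht))
  have hps := (hp t ht).ne'
  have hms := hmass t ht
  rw [hyT t ht] at h2
  have h3 : 1 / ρ t = (m + 2 * A * T t + B * T t ^ 2) / m := by
    rw [div_eq_div_iff hps hm.ne']; linarith
  rw [h3] at h2
  rw [eq_div_iff (by positivity)]
  field_simp at h2
  linarith

/-- The explicit solution of the equations for constant nonzero speed. -/
theorem density_eq_of_speed_ne_zero {J : Set ℝ} (hJ : J.OrdConnected) (h0 : (0 : ℝ) ∈ J)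
    {ρ y : ℝ → ℝ} {κ : ℝ} (hκ : κ ≠ 0) (hp : ∀ t ∈ J, 0 < ρ t)
    (hρ : ∀ t ∈ J, HasDerivWithinAt ρ (y t * ρ t) J t)
    (hy : ∀ t ∈ J, HasDerivWithinAt y (-(1 / 2) * y t ^ 2 - 4 * κ ^ 2 / 2) J t)
    (hi : ρ 0 = 1) {t : ℝ} (ht : t ∈ J) :
    y t = 2 * κ * Real.tan (Real.arctan (y 0 / (2 * κ)) - κ * t) ∧
      ρ t = (Real.cos (κ * t) + y 0 / (2 * κ) * Real.sin (κ * t)) ^ 2 := by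
  set φ : ℝ → ℝ := fun s => Real.sqrt (ρ s) with hφdef
  have hφ : ∀ s ∈ J, HasDerivWithinAt φ (y s / 2 * φ s) J s := fun s hs =>
    hasDerivWithinAt_sqrt_density (hp s hs) (hρ s hs)
  -- With `ψ = yφ/(2κ)` the system is `φ' = κψ`, `ψ' = -κφ`, a uniform rotation. Rotating back by
  -- the angle `κs` gives the two constants of motion `ha` and `hb`.
  have hψ : ∀ s ∈ J, HasDerivWithinAt (fun s => y s / (2 * κ) * φ s) (-κ * φ s) J s := by
    intro s hs
    refine (((hy s hs).div_const (2 * κ)).mul (hφ s hs)).congr_deriv ?_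
    field_simp
    ring
  have hlin : ∀ s : ℝ, HasDerivWithinAt (fun s => κ * s) κ J s := fun s => by
    simpa using (hasDerivWithinAt_id s J).const_mul κ
  have hcos : ∀ s : ℝ, HasDerivWithinAt (fun s => Real.cos (κ * s)) (-Real.sin (κ * s) * κ) J s :=
    fun s => (hlin s).cos
  have hsin : ∀ s : ℝ, HasDerivWithinAt (fun s => Real.sin (κ * s)) (Real.cos (κ * s) * κ) J s :=
    fun s => (hlin s).sin
  have ha := eq_of_hasDerivWithinAt_zero hJ (f := fun s =>
      φ s * Real.cos (κ * s) - y s / (2 * κ) * φ s * Real.sin (κ * s)) (fun s hs => by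
    refine (((hφ s hs).mul (hcos s)).sub ((hψ s hs).mul (hsin s))).congr_deriv ?_
    field_simp
    ring) h0 ht
  have hb := eq_of_hasDerivWithinAt_zero hJ (f := fun s =>
      φ s * Real.sin (κ * s) + y s / (2 * κ) * φ s * Real.cos (κ * s)) (fun s hs => by
    refine (((hφ s hs).mul (hsin s)).add ((hψ s hs).mul (hcos s))).congr_deriv ?_
    field_simp
    ring) h0 ht
  have hφ0 : φ 0 = 1 := by simp [hφdef, hi]
  simp only [hφ0, mul_zero, Real.cos_zero, Real.sin_zero, mul_one, sub_zero, zero_add] at ha hb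
  set b := y 0 / (2 * κ)
  have hcs := Real.sin_sq_add_cos_sq (κ * t)
  have h1 : φ t = Real.cos (κ * t) + b * Real.sin (κ * t) := by
    linear_combination Real.cos (κ * t) * ha + Real.sin (κ * t) * hb - φ t * hcs
  have h2 : y t / (2 * κ) * φ t = b * Real.cos (κ * t) - Real.sin (κ * t) := by
    linear_combination Real.cos (κ * t) * hb - Real.sin (κ * t) * ha - y t / (2 * κ) * φ t * hcs
  have hφpos : 0 < φ t := Real.sqrt_pos.2 (hp t ht)
  constructor
  · have hca := Real.cos_arctan_pos b
    have hsa : Real.sin (Real.arctan b) = b * Real.cos (Real.arctan b) := by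
      have h3 := Real.tan_arctan b
      rw [Real.tan_eq_sin_div_cos, div_eq_iff hca.ne'] at h3
      exact h3
    -- The right side is positive, so the tangent is never evaluated at a pole; it equals `ψ/φ =
    -- y/(2κ)`.
    have hc : Real.cos (Real.arctan b - κ * t) = Real.cos (Real.arctan b) * φ t := by
      rw [Real.cos_sub, hsa, h1]; ring
    have hs : Real.sin (Real.arctan b - κ * t) =
        Real.cos (Real.arctan b) * (y t / (2 * κ) * φ t) := by
      rw [Real.sin_sub, hsa, h2]; ring
    rw [Real.tan_eq_sin_div_cos, hc, hs]
    field_simp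
  · rw [← h1]
    exact (Real.sq_sqrt (hp t ht).le).symm

/-- Here `√ρ` has zero second derivative, so `y√ρ`, twice its first derivative, keeps its initial
value `0`. -/
theorem density_eq_one_of_speed_zero {J : Set ℝ} (hJ : J.OrdConnected) (h0 : (0 : ℝ) ∈ J)
    {ρ y : ℝ → ℝ} (hp : ∀ t ∈ J, 0 < ρ t)
    (hρ : ∀ t ∈ J, HasDerivWithinAt ρ (y t * ρ t) J t)
    (hy : ∀ t ∈ J, HasDerivWithinAt y (-(1 / 2) * y t ^ 2) J t)
    (hi : ρ 0 = 1) (hy0 : y 0 = 0) {t : ℝ} (ht : t ∈ J) : y t = 0 ∧ ρ t = 1 := by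
  have hφ : ∀ s ∈ J, HasDerivWithinAt (fun s => Real.sqrt (ρ s))
      (y s / 2 * Real.sqrt (ρ s)) J s := fun s hs =>
    hasDerivWithinAt_sqrt_density (hp s hs) (hρ s hs)
  have hyz : ∀ s ∈ J, y s = 0 := by
    intro s hs
    have h1 := eq_of_hasDerivWithinAt_zero hJ (f := fun s => y s * Real.sqrt (ρ s))
      (fun s hs => by
        refine ((hy s hs).mul (hφ s hs)).congr_deriv ?_
        ring) h0 hs
    simp only [hy0, zero_mul] at h1
    exact (mul_eq_zero.1 h1).resolve_right (Real.sqrt_pos.2 (hp s hs)).ne'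
  refine ⟨hyz t ht, ?_⟩
  have h2 := eq_of_hasDerivWithinAt_zero hJ (f := ρ) (fun s hs => by
    refine (hρ s hs).congr_deriv ?_
    rw [hyz s hs, zero_mul]) h0 ht
  rw [h2, hi]

end ScalarEquations

/-! ### Conservation of the mean square -/

section EulerArnold

set_option linter.unusedSectionVars false

variable {n : ℕ} {M : Type*} [TopologicalSpace M] [ChartedSpace (EuclideanSpace ℝ (Fin n)) M]
  [IsManifold (𝓡 n) ∞ M] {g : Metric n M} {J : Set ℝ}
  {u : ℝ → (x : M) → TangentSpace (𝓡 n) x} {η : ℝ → M → M} {h : ℝ → M → ℝ}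

theorem continuous_divergence (g : Metric n M) {u : (x : M) → TangentSpace (𝓡 n) x}
    (hu : ContMDiff (𝓡 n) (𝓡 n).tangent ∞ (fun x : M => (⟨x, u x⟩ : TangentBundle (𝓡 n) M))) :
    Continuous (divergence g u) := by
  have hu' : SmoothTimeDependentField univ (fun _ : ℝ => u) :=
    (hu.comp (contMDiff_snd (I := 𝓘(ℝ, ℝ)) (M := ℝ))).contMDiffOn
  rw [continuous_iff_continuousAt]
  intro c
  have h1 := (chartDiv_contDiffOn g uniqueDiffOn_univ hu' c).continuousOn
  have h2 : ContinuousOn (chartDiv g u c) (extChartAt (𝓡 n) c).target :=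
    h1.comp (f := fun z : EuclideanSpace ℝ (Fin n) => ((0 : ℝ), z))
      (continuous_const.prodMk continuous_id).continuousOn
      fun z hz => mk_mem_prod (mem_univ _) hz
  have h3 : ContinuousOn (fun x => chartDiv g u c (extChartAt (𝓡 n) c x))
      (extChartAt (𝓡 n) c).source :=
    h2.comp (continuousOn_extChartAt c) fun x hx => (extChartAt (𝓡 n) c).map_source hx
  refine (h3.congr fun x hx => ?_).continuousAt
    ((isOpen_extChartAt_source c).mem_nhds (mem_extChartAt_source c))
  exact divergence_eq_chartDiv g u
    (fun c' => hu'.chartField_contDiffOn_slice (mem_univ (0 : ℝ)) c') c hx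

variable [MeasurableSpace M]

theorem continuousOn_divergence_flow (hJ : J.OrdConnected) (hn : J.Nontrivial)
    (hu : SmoothTimeDependentField J u) (hη : IsFlow J u η) (hh : SolvesEulerArnold g J u h)
    (x : M) : ContinuousOn (fun t => h t (η t x)) J :=
  fun _ ht => (hh.hasDerivWithinAt_flow hJ hn hu hη ht x).continuousWithinAt

/-- The Gram determinant solves a homogeneous linear equation and is positive at time `0`, so it
never vanishes. From here on roots of it can be differentiated. -/
theorem flowGram_pos (hJ : J.OrdConnected) (hn : J.Nontrivial) (h0J : (0 : ℝ) ∈ J)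
    (hu : SmoothTimeDependentField J u) (hη : IsFlow J u η) (hh : SolvesEulerArnold g J u h)
    {t : ℝ} (ht : t ∈ J) (x : M) : 0 < flowGram g η x t := by
  refine (flowGram_nonneg hη ht x).lt_of_ne' ?_
  refine ne_zero_of_linear_ode hJ (a := fun s => 2 * h s (η s x))
    (continuousOn_const.mul (continuousOn_divergence_flow hJ hn hu hη hh x)) (fun s hs => ?_)
    h0J ht ?_
  · rw [hh.1 s hs]
    exact flowGram_hasDerivWithinAt hJ hn hu hη hs x
  · rw [flowGram_zero hη]
    exact (gramDet_frame_pos g x).ne'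

theorem jacobian_flow_eq (hη : IsFlow J u η) (x : M) (t : ℝ) :
    jacobian g (η t) x = Real.sqrt (flowGram g η x t) / Real.sqrt (flowGram g η x 0) := by
  rw [flowGram_zero hη]; rfl

theorem jacobian_flow_pos (hJ : J.OrdConnected) (hn : J.Nontrivial) (h0J : (0 : ℝ) ∈ J)
    (hu : SmoothTimeDependentField J u) (hη : IsFlow J u η) (hh : SolvesEulerArnold g J u h)
    {t : ℝ} (ht : t ∈ J) (x : M) : 0 < jacobian g (η t) x := by
  rw [jacobian_flow_eq hη]
  exact div_pos (Real.sqrt_pos.2 (flowGram_pos hJ hn h0J hu hη hh ht x))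
    (Real.sqrt_pos.2 (flowGram_pos hJ hn h0J hu hη hh h0J x))

theorem jacobian_flow_hasDerivWithinAt (hJ : J.OrdConnected) (hn : J.Nontrivial)
    (h0J : (0 : ℝ) ∈ J) (hu : SmoothTimeDependentField J u) (hη : IsFlow J u η)
    (hh : SolvesEulerArnold g J u h) {t : ℝ} (ht : t ∈ J) (x : M) :
    HasDerivWithinAt (fun s => jacobian g (η s) x)
      (h t (η t x) * jacobian g (η t) x) J t := by
  have hpos := flowGram_pos hJ hn h0J hu hη hh ht x
  have h1 := flowGram_hasDerivWithinAt (g := g) hJ hn hu hη ht x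
  rw [← hh.1 t ht] at h1
  have h2 := hasDerivWithinAt_sqrt_density (y := fun s => 2 * h s (η s x)) hpos h1
  simp only [jacobian_flow_eq hη]
  refine (h2.div_const _).congr_deriv ?_
  ring

theorem jacobian_flow_zero (hη : IsFlow J u η) (x : M) : jacobian g (η 0) x = 1 := by
  have h0 : η 0 = id := funext hη.initial
  rw [h0, jacobian_id]

theorem IsFlow.bijective [T2Space M] [CompactSpace M] (hJ : J.OrdConnected) (hn : J.Nontrivial)
    (h0J : (0 : ℝ) ∈ J) (hu : SmoothTimeDependentField J u) (hη : IsFlow J u η)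
    (hh : SolvesEulerArnold g J u h) {t : ℝ} (ht : t ∈ J) : Function.Bijective (η t) :=
  ⟨hη.injective hJ h0J hu ht, hη.surjective hJ h0J ht
    (isOpenMap_of_gramDet_ne_zero g (hη.contMDiff ht)
      fun x => (flowGram_pos hJ hn h0J hu hη hh ht x).ne')⟩

/-- The mean square `μ(M)⁻¹ ∫ h² dμ` of a solution is conserved. -/
theorem SolvesEulerArnold.mean_sq_eq [T2Space M] [CompactSpace M] [BorelSpace M] [Nonempty M]
    (hJ : J.OrdConnected) (hn : J.Nontrivial) (h0J : (0 : ℝ) ∈ J)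
    (hu : SmoothTimeDependentField J u) (hη : IsFlow J u η) (hh : SolvesEulerArnold g J u h)
    (hcont : Continuous (h 0)) {t : ℝ} (ht : t ∈ J) :
    1 / (volumeMeasure g).real univ * ∫ y, h t y ^ 2 ∂(volumeMeasure g) =
      1 / (volumeMeasure g).real univ * ∫ y, h 0 y ^ 2 ∂(volumeMeasure g) := by
  set μ := volumeMeasure g
  set m := μ.real univ with hmdef
  have hm : 0 < m := measureReal_univ_pos
  set C : ℝ → ℝ := fun s => 1 / m * ∫ y, h s y ^ 2 ∂μ with hC
  change C t = C 0
  obtain ⟨x₀⟩ := ‹Nonempty M›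
  have hud := uniqueDiffOn_of_ordConnected hJ hn
  have hp : ∀ x, ∀ s ∈ J, 0 < jacobian g (η s) x := fun x s hs =>
    jacobian_flow_pos hJ hn h0J hu hη hh hs x
  have hρ : ∀ x, ∀ s ∈ J, HasDerivWithinAt (fun s => jacobian g (η s) x)
      (h s (η s x) * jacobian g (η s) x) J s := fun x s hs =>
    jacobian_flow_hasDerivWithinAt hJ hn h0J hu hη hh hs x
  have hy : ∀ x, ∀ s ∈ J, HasDerivWithinAt (fun s => h s (η s x))
      (-(1 / 2) * h s (η s x) ^ 2 - C s / 2) J s := fun x s hs => by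
    refine (hh.hasDerivWithinAt_flow hJ hn hu hη hs x).congr_deriv ?_
    simp only [hC, hmdef]
    field_simp
    rfl
  -- The Wronskian of the roots at `x` and `x₀`, evaluated at time `0`.
  set w : M → ℝ := fun x => (h 0 x - h 0 x₀) / 2 with hw
  have hwc : Continuous w := (hcont.sub continuous_const).div_const 2
  set A := ∫ x, w x ∂μ
  set B := ∫ x, w x ^ 2 ∂μ
  have hquot : ∀ x, ∀ s ∈ J, HasDerivWithinAt
      (fun s => Real.sqrt (jacobian g (η s) x) / Real.sqrt (jacobian g (η s) x₀))
      (w x * (1 / jacobian g (η s) x₀)) J s := by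
    intro x s hs
    have h1 := hasDerivWithinAt_sqrt_quotient hJ h0J (hp x) (hp x₀) (hρ x) (hρ x₀) (hy x) (hy x₀)
      (jacobian_flow_zero hη x) (jacobian_flow_zero hη x₀) hs
    simpa only [hη.initial] using h1
  -- a clock which describes all densities in terms of the one at `x₀`
  have hclock : ∃ T : ℝ → ℝ, (∀ s ∈ J, ∀ x, Real.sqrt (jacobian g (η s) x) /
      Real.sqrt (jacobian g (η s) x₀) = 1 + w x * T s) ∧
      ((∃ x, w x ≠ 0) → ∀ s ∈ J, HasDerivWithinAt T (1 / jacobian g (η s) x₀) J s) := by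
    -- The primitive `T` of `1/ρ_{x₀}` is read off from the quotient at one point with `w ≠ 0`, so
    -- nothing has to be integrated in time. If `w` vanishes identically any `T` satisfies the first
    -- claim.
    by_cases hex : ∃ x, w x ≠ 0
    · obtain ⟨x₁, hx₁⟩ := hex
      set T : ℝ → ℝ := fun s =>
        (Real.sqrt (jacobian g (η s) x₁) / Real.sqrt (jacobian g (η s) x₀) - 1) / w x₁ with hTdef
      have hT : ∀ s ∈ J, HasDerivWithinAt T (1 / jacobian g (η s) x₀) J s := fun s hs => by
        refine (((hquot x₁ s hs).sub_const 1).div_const (w x₁)).congr_deriv ?_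
        field_simp
      refine ⟨T, fun s hs x => ?_, fun _ => hT⟩
      have h1 := eq_of_hasDerivWithinAt_zero hJ (f := fun s => Real.sqrt (jacobian g (η s) x) /
        Real.sqrt (jacobian g (η s) x₀) - w x * T s) (fun r hr => by
          refine ((hquot x r hr).sub ((hT r hr).const_mul (w x))).congr_deriv ?_
          ring) h0J hs
      simp only [hTdef, jacobian_flow_zero hη, Real.sqrt_one, div_one, sub_self, zero_div,
        mul_zero, sub_zero] at h1
      simp only [hTdef]
      linarith
    · refine ⟨fun _ => 0, fun s hs x => ?_, fun h => absurd h hex⟩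
      have hwx : w x = 0 := by by_contra hne; exact hex ⟨x, hne⟩
      have h1 := eq_of_hasDerivWithinAt_zero hJ (f := fun s => Real.sqrt (jacobian g (η s) x) /
        Real.sqrt (jacobian g (η s) x₀)) (fun r hr => by
          refine (hquot x r hr).congr_deriv ?_
          rw [hwx, zero_mul]) h0J hs
      simp only [jacobian_flow_zero hη, Real.sqrt_one, div_one] at h1
      rw [h1, mul_zero, add_zero]
  obtain ⟨T, hTeq, hTd⟩ := hclock
  have hjac : ∀ s ∈ J, ∀ x, jacobian g (η s) x =
      jacobian g (η s) x₀ * (1 + w x * T s) ^ 2 := by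
    intro s hs x
    have h1 := hTeq s hs x
    have h2 := Real.sqrt_pos.2 (hp x₀ s hs)
    rw [div_eq_iff h2.ne'] at h1
    have h3 := Real.sq_sqrt (hp x s hs).le
    rw [h1, mul_pow, Real.sq_sqrt (hp x₀ s hs).le] at h3
    linarith
  have hint : ∀ f : M → ℝ, Continuous f → Integrable f μ := fun f hf =>
    hf.integrable_of_hasCompactSupport (HasCompactSupport.of_compactSpace f)
  have hmass : ∀ s ∈ J, jacobian g (η s) x₀ * (m + 2 * A * T s + B * T s ^ 2) = m := by
    intro s hs
    have hc : jacobian g (η s) = fun x => jacobian g (η s) x₀ * (1 + w x * T s) ^ 2 :=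
      funext (hjac s hs)
    -- The measurability required by the change of variables is read off from the formula in terms
    -- of `w`.
    have hcc : Continuous (jacobian g (η s)) := by
      rw [hc]
      exact continuous_const.mul ((continuous_const.add (hwc.mul continuous_const)).pow 2)
    have h1 := integral_jacobian g (hη.contMDiff hs) (hη.bijective hJ hn h0J hu hh hs)
      hcc.measurable
    rw [hc, integral_const_mul] at h1
    have h2 : ∫ x, (1 + w x * T s) ^ 2 ∂μ = m + 2 * A * T s + B * T s ^ 2 := by
      have h3 : ∀ x, (1 + w x * T s) ^ 2 = 1 + (2 * T s) * w x + T s ^ 2 * w x ^ 2 := fun x => by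
        ring
      simp only [h3]
      rw [integral_add (hint _ (by fun_prop)) (hint _ (by fun_prop)),
        integral_add (hint _ (by fun_prop)) (hint _ (by fun_prop)), integral_const_mul,
        integral_const_mul, integral_const, smul_eq_mul, mul_one]
      change m + _ + _ = _
      ring
    rw [← h2]
    exact h1
  by_cases hex : ∃ x, w x ≠ 0
  · have hspeed := fun s (hs : s ∈ J) => speed_eq_of_mass_eq hud hm (hp x₀) (hρ x₀) (hy x₀)
      (hTd hex) hmass hs
    rw [hspeed t ht, hspeed 0 h0J]
  · have hw0 : ∀ x, w x = 0 := fun x => by by_contra hne; exact hex ⟨x, hne⟩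
    have hA : A = 0 := by simp only [A, hw0, integral_zero]
    have hB : B = 0 := by simp [B, hw0]
    have hone : ∀ s ∈ J, jacobian g (η s) x₀ = 1 := fun s hs => by
      have h1 := hmass s hs
      rw [hA, hB] at h1
      have h2 : jacobian g (η s) x₀ * m = 1 * m := by linarith
      exact mul_right_cancel₀ hm.ne' h2
    -- When the initial divergence is constant the density is `1`, so time itself has derivative
    -- `1/ρ_{x₀}` and serves as `T`, with `A = B = 0`.
    have hmass' : ∀ s ∈ J, jacobian g (η s) x₀ * (m + 2 * A * s + B * s ^ 2) = m := fun s hs => by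
      rw [hone s hs, hA, hB]; ring
    have hspeed := fun s (hs : s ∈ J) => speed_eq_of_mass_eq hud hm (hp x₀) (hρ x₀) (hy x₀)
      (T := fun s => s) (fun r hr => by
        rw [hone r hr, div_one]
        exact hasDerivWithinAt_id r J) hmass' hs
    rw [hspeed t ht, hspeed 0 h0J]

end EulerArnold

end FisherRao

end

/-! ### The explicit solution, including the degenerate cases -/

theorem mainTheorem7 {n : ℕ} {M : Type*} [TopologicalSpace M] [T2Space M] [CompactSpace M]
    [ChartedSpace (EuclideanSpace ℝ (Fin n)) M] [IsManifold (𝓡 n) ∞ M]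
    [MeasurableSpace M] [BorelSpace M]
    (g : FisherRao.Metric n M)
    (J : Set ℝ) (hJ : J.OrdConnected) (h0J : (0 : ℝ) ∈ J)
    (u₀ : (x : M) → TangentSpace (𝓡 n) x)
    (hu₀ : ContMDiff (𝓡 n) (𝓡 n).tangent ∞
      (fun x : M => (⟨x, u₀ x⟩ : TangentBundle (𝓡 n) M)))
    (u : ℝ → (x : M) → TangentSpace (𝓡 n) x)
    (hu : FisherRao.SmoothTimeDependentField J u)
    (h : ℝ → M → ℝ) (hh : FisherRao.SolvesEulerArnold g J u h)
    (hinit : ∀ x, h 0 x = FisherRao.divergence g u₀ x)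
    (η : ℝ → M → M) (hη : FisherRao.IsFlow J u η)
    (κ : ℝ)
    (hκ : κ ^ 2 = 1 / (4 * (FisherRao.volumeMeasure g).real univ) *
      ∫ x, FisherRao.divergence g u₀ x ^ 2 ∂(FisherRao.volumeMeasure g)) :
    (∀ t ∈ J, 1 / (4 * (FisherRao.volumeMeasure g).real univ) *
      ∫ x, FisherRao.divergence g (u t) x ^ 2 ∂(FisherRao.volumeMeasure g) = κ ^ 2) ∧
    (κ ≠ 0 → ∀ t ∈ J, ∀ x,
      h t (η t x) =
          2 * κ * Real.tan (Real.arctan (FisherRao.divergence g u₀ x / (2 * κ)) - κ * t) ∧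
      FisherRao.jacobian g (η t) x =
          (Real.cos (κ * t) +
            FisherRao.divergence g u₀ x / (2 * κ) * Real.sin (κ * t)) ^ 2) ∧
    (κ = 0 → ∀ t ∈ J, ∀ x, h t (η t x) = 0 ∧ FisherRao.jacobian g (η t) x = 1) := by
  have hcont : Continuous (h 0) := by
    have : h 0 = FisherRao.divergence g u₀ := funext hinit
    rw [this]
    exact FisherRao.continuous_divergence g hu₀
  have hdiv : ∀ t ∈ J, ∫ x, FisherRao.divergence g (u t) x ^ 2 ∂(FisherRao.volumeMeasure g) =
      ∫ x, h t x ^ 2 ∂(FisherRao.volumeMeasure g) := fun t ht => by simp only [hh.1 t ht]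
  simp only [← hinit] at hκ ⊢
  have hconserved : ∀ t ∈ J, 1 / (4 * (FisherRao.volumeMeasure g).real univ) *
      ∫ x, h t x ^ 2 ∂(FisherRao.volumeMeasure g) = κ ^ 2 := by
    intro t ht
    rcases isEmpty_or_nonempty M with hM | hM
    · rw [hκ]
      simp [Measure.eq_zero_of_isEmpty]
    -- If `J = {0}`, derivatives within `J` carry no information, but only `t = 0` has to be
    -- checked.
    · rcases J.subsingleton_or_nontrivial with hs | hn
      · rw [hκ, hs ht h0J]
      · have h1 := hh.mean_sq_eq hJ hn h0J hu hη hcont ht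
        rw [hκ]
        simp only [one_div, mul_inv] at h1 ⊢
        rw [mul_assoc, mul_assoc, h1]
  -- A continuous function whose square has zero integral vanishes, since `μ` charges every nonempty
  -- open set.
  have hzero : κ = 0 → ∀ x, h 0 x = 0 := by
    intro hκ0 x
    by_contra hne
    have : Nonempty M := ⟨x⟩
    have hm : 0 < (FisherRao.volumeMeasure g).real univ := measureReal_univ_pos
    have hpos : 0 < ∫ y, h 0 y ^ 2 ∂(FisherRao.volumeMeasure g) :=
      (hcont.pow 2).integral_pos_of_hasCompactSupport_nonneg_nonzero
        (HasCompactSupport.of_compactSpace _) (fun y => sq_nonneg _) (x := x)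
        (pow_ne_zero 2 hne)
    rw [hκ0] at hκ
    have : 0 < 1 / (4 * (FisherRao.volumeMeasure g).real univ) *
      ∫ y, h 0 y ^ 2 ∂(FisherRao.volumeMeasure g) := by positivity
    linarith
  refine ⟨fun t ht => by rw [hdiv t ht]; exact hconserved t ht, fun hκ0 t ht x => ?_,
    fun hκ0 t ht x => ?_⟩
  · rcases J.subsingleton_or_nontrivial with hs | hn
    · obtain rfl := hs ht h0J
      rw [hη.initial, FisherRao.jacobian_flow_zero hη]
      simp only [mul_zero, sub_zero, Real.tan_arctan, Real.cos_zero, Real.sin_zero, add_zero,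
        one_pow, and_true]
      field_simp
    · have h1 := FisherRao.density_eq_of_speed_ne_zero hJ h0J hκ0
        (fun s hs => FisherRao.jacobian_flow_pos hJ hn h0J hu hη hh hs x)
        (fun s hs => FisherRao.jacobian_flow_hasDerivWithinAt hJ hn h0J hu hη hh hs x)
        -- Conservation turns the nonlocal term into the constant `2κ²`, so `C = 4κ²` in the Riccati
        -- equation.
        (fun s hs => by
          refine (hh.hasDerivWithinAt_flow hJ hn hu hη hs x).congr_deriv ?_
          rw [← hconserved s hs]
          have : (1 : ℝ) / (2 * (FisherRao.volumeMeasure g).real univ) =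
              4 / 2 * (1 / (4 * (FisherRao.volumeMeasure g).real univ)) := by
            simp only [one_div, mul_inv]; ring
          rw [this]
          ring) (FisherRao.jacobian_flow_zero hη x) ht
      simpa only [hη.initial] using h1
  · rcases J.subsingleton_or_nontrivial with hs | hn
    · obtain rfl := hs ht h0J
      rw [hη.initial, FisherRao.jacobian_flow_zero hη]
      exact ⟨hzero hκ0 x, rfl⟩
    · refine FisherRao.density_eq_one_of_speed_zero hJ h0J
        (fun s hs => FisherRao.jacobian_flow_pos hJ hn h0J hu hη hh hs x)
        (fun s hs => FisherRao.jacobian_flow_hasDerivWithinAt hJ hn h0J hu hη hh hs x)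
        (fun s hs => by
          refine (hh.hasDerivWithinAt_flow hJ hn hu hη hs x).congr_deriv ?_
          have h1 := hconserved s hs
          have : (1 : ℝ) / (2 * (FisherRao.volumeMeasure g).real univ) =
              4 / 2 * (1 / (4 * (FisherRao.volumeMeasure g).real univ)) := by
            simp only [one_div, mul_inv]; ring
          rw [this, mul_assoc, h1, hκ0]
          ring) (FisherRao.jacobian_flow_zero hη x) ?_ ht
      rw [hη.initial]
      exact hzero hκ0 x
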